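/- For $a,b,c,d,x,y\in\mathbb{C}$ let $$H_1(a,b,c;d;x,y)=\sum_{m,n\ge 0}\frac{(a)_{m-n}(b)_{m+n}(c)_n}{(d)_m\,m!\,n!}\,x^m y^n$$ be Horn's series, where $(a)_k=\Gamma(a+k)/\Gamma(a)$ for $k\in\mathbb{Z}$ (so $(a)_{-n}=1/((a-1)(a-2)\cdots(a-n))$), and let $$\phi(s,t)=\left(\frac{(s^4-1)(t^4-1)}{(s^2t^2-1)^2},\ \left(\frac{st+1}{st-1}\right)^2\right).$$ Let $q_0\in\mathbb{C}$ be such that neither $2q_0$ nor $2-2q_0$ is a non-positive integer. Then for all $(u,v)$ near $(0,0)$ with $v\neq 0$ the value $\phi(-1+2uv,1+2v)$ is defined, and this map of $(u,v)$ extends across $v=0$ to a map $\Phi$ that is holomorphic at $(0,0)$ with $\Phi(0,0)=(0,0)$. Near $(0,0)$ the series $H_1\left(q_0-\tfrac12,\,q_0,\,\tfrac12;\,2q_0;\,\Phi(u,v)\right)$ converges absolutely, its sum is holomorphic at $(0,0)$ as a function of $(u,v)$, and for all $(u,v)$ in a neighbourhood of $(0,0)$ $$\begin{aligned} H_1\left(q_0-\tfrac12,\,q_0,\,\tfrac12;\,2q_0;\,\Phi(u,v)\right)={}&(1+v-uv-2uv^2)^{2q_0}\left(\frac{1-u-2uv}{(1+v)(1+2v+2v^2)}\right)^{2q_0-1}\\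 &\times{}_2F_1\left(1-q_0,\tfrac34-q_0;\,2-2q_0;\,-8v(1+v)(1+2v+2v^2)\right)\\ &\times{}_2F_1\left(q_0-\tfrac14,q_0;\,2q_0;\,8uv(1-uv)(1-2uv+2u^2v^2)\right), \end{aligned}$$ where the powers take their principal values. The right-hand side is also holomorphic at $(0,0)$. -/

import Mathlib

open Filter Topology

/-- The Pochhammer symbol `(a)_k = Γ(a + k) / Γ(a)` for an integer index `k`:
`(a)_n = a (a + 1) ⋯ (a + n - 1)` for `n ≥ 0`, and
`(a)_{-n} = 1 / ((a - n) (a - n + 1) ⋯ (a - 1))` for `n ≥ 1`. -/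
noncomputable def intPochhammer (a : ℂ) : ℤ → ℂ
  | Int.ofNat n => (ascPochhammer ℂ n).eval a
  | Int.negSucc n => ((ascPochhammer ℂ (n + 1)).eval (a - ((n : ℂ) + 1)))⁻¹

/-- The `(m, n)` term of Horn's double series `H₁(a, b, c; d; x, y)`. -/
noncomputable def hornH1Term (a b c d x y : ℂ) (m n : ℕ) : ℂ :=
  intPochhammer a ((m : ℤ) - (n : ℤ)) * (ascPochhammer ℂ (m + n)).eval b *
      (ascPochhammer ℂ n).eval c /
    ((ascPochhammer ℂ m).eval d * (m.factorial : ℂ) * (n.factorial : ℂ)) * x ^ m * y ^ n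

/-- Horn's hypergeometric series `H₁(a, b, c; d; x, y)`. -/
noncomputable def hornH1 (a b c d x y : ℂ) : ℂ :=
  ∑' p : ℕ × ℕ, hornH1Term a b c d x y p.1 p.2

/-- The rational map `φ(s, t)`; it is meaningful where `s² t² ≠ 1`. -/
noncomputable def hornPhi (s t : ℂ) : ℂ × ℂ :=
  ((s ^ 4 - 1) * (t ^ 4 - 1) / (s ^ 2 * t ^ 2 - 1) ^ 2, ((s * t + 1) / (s * t - 1)) ^ 2)

/-- The product of Gauss hypergeometric functions (with its prefactor, principal powers). -/
noncomputable def gaussProduct (q₀ u v : ℂ) : ℂ :=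
  (1 + v - u * v - 2 * u * v ^ 2) ^ (2 * q₀) *
    ((1 - u - 2 * u * v) / ((1 + v) * (1 + 2 * v + 2 * v ^ 2))) ^ (2 * q₀ - 1) *
    ₂F₁ (1 - q₀) (3 / 4 - q₀) (2 - 2 * q₀) (-8 * v * (1 + v) * (1 + 2 * v + 2 * v ^ 2)) *
    ₂F₁ (q₀ - 1 / 4) q₀ (2 * q₀)
      (8 * u * v * (1 - u * v) * (1 - 2 * u * v + 2 * u ^ 2 * v ^ 2))

/-! With `s = -1 + 2uv` and `t = 1 + 2v`, the map `φ` separates variables. Write `P` for the product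
of the two principal powers on the right-hand side. For fixed `t`, a suitable combination of the two
partial differential equations of `H₁` makes `H₁(φ(s, t)) / P` a solution in `s` of the ordinary
equation `QuarticODE q`, which is the equation of `₂F₁(q, q - 1/4; 2q; z)` pulled back along `z = 1
- s⁴` (`hornH1_hornPhi_quarticODE`). At a fourth root of unity this equation has exponents `0` and
`1 - 2q`. Since `2q` is not a non-positive integer, a holomorphic solution there is determined by
its value (`QuarticODE.eqOn_const_mul`). Hence `H₁ / P` is the second Gauss factor times a function
of `t` alone.

That function is read off at `s = -1`, i.e. `u = 0`. There `x = 0`, and what remains of the second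
partial differential equation is the same quartic equation in `t`, with `q` replaced by `1 - q`
(`hornH1_hornPhi_neg_one_quarticODE`). Uniqueness at `t = 1`, where everything equals `1`, yields
the first Gauss factor (`hornH1_hornPhiExt_zero_left`).

This proves the identity for `v ≠ 0` (`hornH1_hornPhiExt_of_ne`), and continuity extends it to `v =
0`. All analysis of the series rests on one geometric bound for the coefficients
(`geomBound_hornCoeff`). -/

/-! ### Double power series with geometrically bounded coefficients -/

/-- The sum of the double power series with coefficients `A m n`. -/
noncomputable def doubleSeries (A : ℕ → ℕ → ℂ) (x y : ℂ) : ℂ :=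
  ∑' p : ℕ × ℕ, A p.1 p.2 * x ^ p.1 * y ^ p.2

/-- The coefficients `A m n` are bounded by a multiple of `K ^ (m + n)`. -/
def GeomBound (A : ℕ → ℕ → ℂ) (K : ℝ) : Prop :=
  ∃ C : ℝ, 0 ≤ C ∧ ∀ m n, ‖A m n‖ ≤ C * K ^ (m + n)

/-- Each Euler operator `x ∂/∂x` or `y ∂/∂y` costs a factor `2` in the growth rate, by `m ≤ 2 ^ m`.
Two of them cost `4`, which is the origin of the condition `4 * K * ρ < 1` below. -/
theorem GeomBound.natCast_fst_mul {A : ℕ → ℕ → ℂ} {K : ℝ} (h : GeomBound A K) :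
    GeomBound (fun m n => (m : ℂ) * A m n) (2 * K) := by
  obtain ⟨C, hC, h⟩ := h
  refine ⟨C, hC, fun m n => ?_⟩
  rw [norm_mul, Complex.norm_natCast, mul_pow]
  have h2 : (m : ℝ) ≤ 2 ^ (m + n) := by
    have : m < 2 ^ m := Nat.lt_two_pow_self
    have h3 : 2 ^ m ≤ 2 ^ (m + n) := Nat.pow_le_pow_right (by norm_num) (by omega)
    exact_mod_cast (this.le.trans h3)
  calc (m : ℝ) * ‖A m n‖ ≤ 2 ^ (m + n) * (C * K ^ (m + n)) := by
        gcongr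
        exact h m n
    _ = _ := by ring

theorem GeomBound.natCast_snd_mul {A : ℕ → ℕ → ℂ} {K : ℝ} (h : GeomBound A K) :
    GeomBound (fun m n => (n : ℂ) * A m n) (2 * K) := by
  obtain ⟨C, hC, h⟩ := h
  refine ⟨C, hC, fun m n => ?_⟩
  rw [norm_mul, Complex.norm_natCast, mul_pow]
  have h2 : (n : ℝ) ≤ 2 ^ (m + n) := by
    have : n < 2 ^ n := Nat.lt_two_pow_self
    have h3 : 2 ^ n ≤ 2 ^ (m + n) := Nat.pow_le_pow_right (by norm_num) (by omega)
    exact_mod_cast (this.le.trans h3)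
  calc (n : ℝ) * ‖A m n‖ ≤ 2 ^ (m + n) * (C * K ^ (m + n)) := by
        gcongr
        exact h m n
    _ = _ := by ring

/-- A single Weierstrass majorant on the closed bidisc of radius `ρ`; summability, continuity and
termwise differentiation all follow from it. -/
theorem GeomBound.exists_majorant {A : ℕ → ℕ → ℂ} {K ρ : ℝ} (h : GeomBound A K) (hK : 0 ≤ K)
    (hρ : 0 ≤ ρ) (hKρ : K * ρ < 1) :
    ∃ w : ℕ × ℕ → ℝ, Summable w ∧ ∀ (p : ℕ × ℕ) (x y : ℂ), ‖x‖ ≤ ρ → ‖y‖ ≤ ρ →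
      ‖A p.1 p.2 * x ^ p.1 * y ^ p.2‖ ≤ w p := by
  obtain ⟨C, hC, h⟩ := h
  have hg := summable_geometric_of_lt_one (mul_nonneg hK hρ) hKρ
  refine ⟨fun p => C * ((K * ρ) ^ p.1 * (K * ρ) ^ p.2),
    (hg.mul_of_nonneg hg (fun _ => by positivity) (fun _ => by positivity)).mul_left C, ?_⟩
  intro p x y hx hy
  rw [norm_mul, norm_mul, norm_pow, norm_pow]
  calc ‖A p.1 p.2‖ * ‖x‖ ^ p.1 * ‖y‖ ^ p.2 ≤ (C * K ^ (p.1 + p.2)) * ρ ^ p.1 * ρ ^ p.2 := by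
        gcongr
        exact h _ _
    _ = C * ((K * ρ) ^ p.1 * (K * ρ) ^ p.2) := by rw [mul_pow, mul_pow, pow_add]; ring

theorem GeomBound.summable {A : ℕ → ℕ → ℂ} {K ρ : ℝ} (h : GeomBound A K) (hK : 0 ≤ K)
    (hKρ : K * ρ < 1) {x y : ℂ} (hx : ‖x‖ ≤ ρ) (hy : ‖y‖ ≤ ρ) :
    Summable fun p : ℕ × ℕ => A p.1 p.2 * x ^ p.1 * y ^ p.2 := by
  obtain ⟨w, hw, hb⟩ := h.exists_majorant hK ((norm_nonneg x).trans hx) hKρ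
  exact Summable.of_norm_bounded hw fun p => hb p x y hx hy

/-- Turns a coefficient recurrence into a differential equation. Both sides are one sum reindexed,
so no convergence is needed. -/
theorem doubleSeries_shift_fst {A B : ℕ → ℕ → ℂ} (h₀ : ∀ n, A 0 n = 0)
    (h : ∀ m n, A (m + 1) n = B m n) (x y : ℂ) :
    doubleSeries A x y = x * doubleSeries B x y := by
  unfold doubleSeries
  rw [← tsum_mul_left]
  have hi : Function.Injective fun p : ℕ × ℕ => (p.1 + 1, p.2) := by
    rintro ⟨a, b⟩ ⟨c, d⟩ h
    simpa using h
  rw [← hi.tsum_eq]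
  · exact tsum_congr fun p => by simp only [h]; ring
  · rintro ⟨m, n⟩ hp
    rcases m with _ | m
    · simp [h₀] at hp
    · exact ⟨(m, n), rfl⟩

theorem doubleSeries_shift_snd {A B : ℕ → ℕ → ℂ} (h₀ : ∀ m, A m 0 = 0)
    (h : ∀ m n, A m (n + 1) = B m n) (x y : ℂ) :
    doubleSeries A x y = y * doubleSeries B x y := by
  unfold doubleSeries
  rw [← tsum_mul_left]
  have hi : Function.Injective fun p : ℕ × ℕ => (p.1, p.2 + 1) := by
    rintro ⟨a, b⟩ ⟨c, d⟩ h
    simpa using h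
  rw [← hi.tsum_eq]
  · exact tsum_congr fun p => by simp only [h]; ring
  · rintro ⟨m, n⟩ hp
    rcases n with _ | n
    · simp [h₀] at hp
    · exact ⟨(m, n), rfl⟩

theorem doubleSeries_zero_left {A : ℕ → ℕ → ℂ} (h₀ : ∀ n, A 0 n = 0) (y : ℂ) :
    doubleSeries A 0 y = 0 := by
  simpa using doubleSeries_shift_fst (B := fun m n => A (m + 1) n) h₀ (fun _ _ => rfl) 0 y

theorem doubleSeries_zero_right {A : ℕ → ℕ → ℂ} (h₀ : ∀ m, A m 0 = 0) (x : ℂ) :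
    doubleSeries A x 0 = 0 := by
  simpa using doubleSeries_shift_snd (B := fun m n => A m (n + 1)) h₀ (fun _ _ => rfl) x 0

theorem doubleSeries_zero_zero (A : ℕ → ℕ → ℂ) : doubleSeries A 0 0 = A 0 0 := by
  unfold doubleSeries
  rw [tsum_eq_single (0, 0)]
  · simp
  · rintro ⟨m, n⟩ h
    rcases m with _ | m <;> rcases n with _ | n <;> simp_all

theorem GeomBound.continuousOn {A : ℕ → ℕ → ℂ} {K ρ : ℝ} (h : GeomBound A K) (hK : 0 ≤ K)
    (hρ : 0 ≤ ρ) (hKρ : K * ρ < 1) :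
    ContinuousOn (fun p : ℂ × ℂ => doubleSeries A p.1 p.2) {p | ‖p.1‖ ≤ ρ ∧ ‖p.2‖ ≤ ρ} := by
  obtain ⟨w, hw, hb⟩ := h.exists_majorant hK hρ hKρ
  exact continuousOn_tsum (fun i => by fun_prop) hw fun p z hz => hb p _ _ hz.1 hz.2

theorem GeomBound.continuousAt {A : ℕ → ℕ → ℂ} {K ρ : ℝ} (h : GeomBound A K) (hK : 0 ≤ K)
    (hρ : 0 ≤ ρ) (hKρ : K * ρ < 1) {z : ℂ × ℂ} (hz₁ : ‖z.1‖ < ρ) (hz₂ : ‖z.2‖ < ρ) :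
    ContinuousAt (fun p : ℂ × ℂ => doubleSeries A p.1 p.2) z := by
  refine (h.continuousOn hK hρ hKρ).continuousAt ?_
  filter_upwards [(isOpen_lt continuous_fst.norm continuous_const).mem_nhds hz₁,
    (isOpen_lt continuous_snd.norm continuous_const).mem_nhds hz₂] with p h1 h2
  exact ⟨le_of_lt h1, le_of_lt h2⟩

theorem GeomBound.differentiableOn {A : ℕ → ℕ → ℂ} {K ρ : ℝ} (h : GeomBound A K) (hK : 0 ≤ K)
    (hρ : 0 ≤ ρ) (hKρ : K * ρ < 1) {U : Set ℂ} (hU : IsOpen U) {x y : ℂ → ℂ}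
    (hx : DifferentiableOn ℂ x U) (hy : DifferentiableOn ℂ y U)
    (hxρ : ∀ s ∈ U, ‖x s‖ ≤ ρ) (hyρ : ∀ s ∈ U, ‖y s‖ ≤ ρ) :
    DifferentiableOn ℂ (fun s => doubleSeries A (x s) (y s)) U := by
  obtain ⟨w, hw, hb⟩ := h.exists_majorant hK hρ hKρ
  refine Complex.differentiableOn_tsum_of_summable_norm hw (fun i => by fun_prop) hU ?_
  exact fun p s hs => hb p _ _ (hxρ s hs) (hyρ s hs)

/-- Term-by-term differentiation of a double series along a curve with logarithmic derivatives
`ξ` and `η`. -/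
theorem GeomBound.hasDerivAt {A : ℕ → ℕ → ℂ} {K ρ : ℝ} (h : GeomBound A K) (hK : 0 ≤ K)
    (hρ : 0 ≤ ρ) (hKρ : 2 * K * ρ < 1) {U : Set ℂ} (hU : IsOpen U) {x y ξ η : ℂ → ℂ}
    (hx : ∀ s ∈ U, HasDerivAt x (ξ s * x s) s) (hy : ∀ s ∈ U, HasDerivAt y (η s * y s) s)
    (hxρ : ∀ s ∈ U, ‖x s‖ ≤ ρ) (hyρ : ∀ s ∈ U, ‖y s‖ ≤ ρ) {s : ℂ} (hs : s ∈ U) :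
    HasDerivAt (fun s => doubleSeries A (x s) (y s))
      (ξ s * doubleSeries (fun m n => (m : ℂ) * A m n) (x s) (y s) +
        η s * doubleSeries (fun m n => (n : ℂ) * A m n) (x s) (y s)) s := by
  have hKρ' : K * ρ < 1 := by nlinarith [mul_nonneg hK hρ]
  have hxd : DifferentiableOn ℂ x U := fun s hs => (hx s hs).differentiableAt.differentiableWithinAt
  have hyd : DifferentiableOn ℂ y U := fun s hs => (hy s hs).differentiableAt.differentiableWithinAt
  have hd := (h.differentiableOn hK hρ hKρ' hU hxd hyd hxρ hyρ).differentiableAt (hU.mem_nhds hs)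
  obtain ⟨w, hw, hb⟩ := h.exists_majorant hK hρ hKρ'
  have hsum := Complex.hasSum_deriv_of_summable_norm
    (F := fun (p : ℕ × ℕ) s => A p.1 p.2 * x s ^ p.1 * y s ^ p.2) hw
    (fun i => by fun_prop) hU (fun p s hs => hb p _ _ (hxρ s hs) (hyρ s hs)) hs
  have h1 := (h.natCast_fst_mul.summable (by positivity) hKρ (hxρ s hs) (hyρ s hs)).hasSum
  have h2 := (h.natCast_snd_mul.summable (by positivity) hKρ (hxρ s hs) (hyρ s hs)).hasSum
  have h3 := (h1.mul_left (ξ s)).add (h2.mul_left (η s))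
  have h4 : deriv (fun s => doubleSeries A (x s) (y s)) s = _ := hsum.unique (by
    refine h3.congr_fun ?_
    rintro ⟨m, n⟩
    -- Because `x' = ξ x`, differentiating a power only multiplies it by `m ξ`: the exponents do not
    -- shift, and derivatives are expressed by Euler operators.
    have hm : HasDerivAt (fun s => x s ^ m) (m * ξ s * x s ^ m) s := by
      refine ((hx s hs).pow m).congr_deriv ?_
      rcases m with _ | m
      · simp
      · simp only [Nat.add_sub_cancel]; ring
    have hn : HasDerivAt (fun s => y s ^ n) (n * η s * y s ^ n) s := by
      refine ((hy s hs).pow n).congr_deriv ?_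
      rcases n with _ | n
      · simp
      · simp only [Nat.add_sub_cancel]; ring
    refine ((hm.const_mul (A m n)).fun_mul hn).deriv.trans ?_
    ring)
  exact hd.hasDerivAt.congr_deriv h4

/-! ### Pochhammer symbols, recurrences and growth of Horn's coefficients -/

theorem ascPochhammer_eval_succ_right' (n : ℕ) (a : ℂ) :
    (ascPochhammer ℂ (n + 1)).eval a = (ascPochhammer ℂ n).eval a * (a + n) := by
  simp [ascPochhammer_succ_right]

theorem ascPochhammer_eval_succ_left' (n : ℕ) (a : ℂ) :
    (ascPochhammer ℂ (n + 1)).eval a = a * (ascPochhammer ℂ n).eval (a + 1) := by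
  simp [ascPochhammer_succ_left, Polynomial.eval_comp]

theorem ascPochhammer_eval_ne_zero {a : ℂ} (ha : ∀ n : ℕ, a + n ≠ 0) (n : ℕ) :
    (ascPochhammer ℂ n).eval a ≠ 0 := by
  induction n with
  | zero => simp
  | succ n ih => rw [ascPochhammer_eval_succ_right']; exact mul_ne_zero ih (ha n)

theorem ascPochhammer_eval_sub (n : ℕ) (a : ℂ) :
    (ascPochhammer ℂ n).eval (a - n) = (-1) ^ n * (ascPochhammer ℂ n).eval (1 - a) := by
  induction n with
  | zero => simp
  | succ n ih =>
    rw [ascPochhammer_eval_succ_left', ascPochhammer_eval_succ_right']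
    have : a - ((n + 1 : ℕ) : ℂ) + 1 = a - n := by push_cast; ring
    rw [this, ih]
    push_cast
    ring

theorem intPochhammer_natCast (a : ℂ) (n : ℕ) :
    intPochhammer a n = (ascPochhammer ℂ n).eval a := rfl

theorem intPochhammer_neg_natCast (a : ℂ) (n : ℕ) :
    intPochhammer a (-(n : ℤ)) = ((-1) ^ n * (ascPochhammer ℂ n).eval (1 - a))⁻¹ := by
  rcases n with _ | n
  · simp [intPochhammer]
  · have : -((n + 1 : ℕ) : ℤ) = Int.negSucc n := rfl
    rw [this, ← ascPochhammer_eval_sub]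
    simp [intPochhammer]

/-- The condition says that `a` is not a positive integer, so no denominator of a negative-index
symbol vanishes and the usual recurrence holds across index `0`. -/
theorem intPochhammer_add_one {a : ℂ} (ha : ∀ n : ℕ, 1 - a + n ≠ 0) (k : ℤ) :
    intPochhammer a (k + 1) = intPochhammer a k * (a + k) := by
  obtain ⟨n, rfl | rfl⟩ := k.eq_nat_or_neg
  · exact_mod_cast ascPochhammer_eval_succ_right' n a
  · rcases n with _ | n
    · simp [intPochhammer]
    · have : -((n + 1 : ℕ) : ℤ) + 1 = -(n : ℤ) := by push_cast; ring
      rw [this, intPochhammer_neg_natCast, intPochhammer_neg_natCast,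
        ascPochhammer_eval_succ_right']
      have h1 := ascPochhammer_eval_ne_zero ha n
      have h2 := ha n
      have h3 : ((-1 : ℂ)) ^ n ≠ 0 := pow_ne_zero _ (by norm_num)
      rw [pow_succ]
      push_cast
      field_simp
      ring

/-- The coefficients of Horn's series `H₁(a, b, c; d; x, y)`. -/
noncomputable def hornCoeff (a b c d : ℂ) (m n : ℕ) : ℂ :=
  intPochhammer a ((m : ℤ) - (n : ℤ)) * (ascPochhammer ℂ (m + n)).eval b *
      (ascPochhammer ℂ n).eval c /
    ((ascPochhammer ℂ m).eval d * (m.factorial : ℂ) * (n.factorial : ℂ))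

theorem hornH1_eq_doubleSeries (a b c d x y : ℂ) :
    hornH1 a b c d x y = doubleSeries (hornCoeff a b c d) x y := rfl

theorem hornCoeff_zero_zero (a b c d : ℂ) : hornCoeff a b c d 0 0 = 1 := by
  simp [hornCoeff, intPochhammer]

theorem hornCoeff_succ_fst {a d : ℂ} (ha : ∀ n : ℕ, 1 - a + n ≠ 0) (hd : ∀ n : ℕ, d + n ≠ 0)
    (b c : ℂ) (m n : ℕ) :
    ((m : ℂ) + 1) * (d + m) * hornCoeff a b c d (m + 1) n =
      (a + m - n) * (b + m + n) * hornCoeff a b c d m n := by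
  have h1 := ascPochhammer_eval_ne_zero hd m
  have h2 := hd m
  have h3 : (m.factorial : ℂ) ≠ 0 := by exact_mod_cast m.factorial_ne_zero
  have h4 : (n.factorial : ℂ) ≠ 0 := by exact_mod_cast n.factorial_ne_zero
  have h5 : (m : ℂ) + 1 ≠ 0 := by exact_mod_cast m.succ_ne_zero
  have e1 : ((m + 1 : ℕ) : ℤ) - (n : ℤ) = ((m : ℤ) - n) + 1 := by push_cast; ring
  have e2 : m + 1 + n = (m + n) + 1 := by ring
  unfold hornCoeff
  rw [e1, e2, intPochhammer_add_one ha, ascPochhammer_eval_succ_right',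
    ascPochhammer_eval_succ_right', Nat.factorial_succ]
  push_cast
  field_simp
  ring

theorem hornCoeff_succ_snd {a : ℂ} (ha : ∀ n : ℕ, 1 - a + n ≠ 0)
    (b c d : ℂ) (m n : ℕ) :
    ((n : ℂ) + 1) * (a + m - (n + 1)) * hornCoeff a b c d m (n + 1) =
      (b + m + n) * (c + n) * hornCoeff a b c d m n := by
  have h4 : (n.factorial : ℂ) ≠ 0 := by exact_mod_cast n.factorial_ne_zero
  have h5 : (n : ℂ) + 1 ≠ 0 := by exact_mod_cast n.succ_ne_zero
  have e1 : (m : ℤ) - (n : ℤ) = ((m : ℤ) - (n + 1 : ℕ)) + 1 := by push_cast; ring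
  have e2 : m + (n + 1) = (m + n) + 1 := by ring
  unfold hornCoeff
  rw [e1, e2, intPochhammer_add_one ha, ascPochhammer_eval_succ_right',
    ascPochhammer_eval_succ_right', Nat.factorial_succ]
  push_cast
  rw [mul_div_assoc', mul_div_assoc']
  -- If `(d)_m = 0`, both coefficients are `0` by the convention for division by zero, so `d` needs
  -- no restriction here.
  by_cases h : (ascPochhammer ℂ m).eval d = 0
  · simp [h]
  have h3 : (m.factorial : ℂ) ≠ 0 := by exact_mod_cast m.factorial_ne_zero
  field_simp
  ring

theorem norm_ascPochhammer_eval_le (a : ℂ) (n : ℕ) :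
    ‖(ascPochhammer ℂ n).eval a‖ ≤ (‖a‖ + 1) ^ n * n.factorial := by
  induction n with
  | zero => simp
  | succ n ih =>
    rw [ascPochhammer_eval_succ_right', norm_mul, Nat.factorial_succ, pow_succ]
    have h : ‖a + n‖ ≤ (‖a‖ + 1) * (n + 1) := by
      refine (norm_add_le _ _).trans ?_
      rw [Complex.norm_natCast]
      nlinarith [norm_nonneg a, mul_nonneg (norm_nonneg a) n.cast_nonneg (α := ℝ)]
    push_cast
    calc _ ≤ ((‖a‖ + 1) ^ n * n.factorial) * ((‖a‖ + 1) * (n + 1)) := by gcongr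
      _ = _ := by ring

theorem exists_natCast_add_one_le_norm_add {a : ℂ} (ha : ∀ n : ℕ, a + n ≠ 0) :
    ∃ κ : ℝ, 1 ≤ κ ∧ ∀ n : ℕ, (n : ℝ) + 1 ≤ κ * ‖a + n‖ := by
  obtain ⟨N, hN⟩ := exists_nat_ge (2 * ‖a‖ + 1)
  have hs : (0 : ℝ) ≤ ∑ n ∈ Finset.range N, ((n : ℝ) + 1) / ‖a + n‖ :=
    Finset.sum_nonneg fun n _ => by positivity
  -- The sum handles the finitely many `n < N`. For `n ≥ N ≥ 2‖a‖ + 1` the constant `3` suffices,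
  -- since `‖a + n‖ ≥ n - ‖a‖`.
  refine ⟨3 + ∑ n ∈ Finset.range N, ((n : ℝ) + 1) / ‖a + n‖, by linarith, fun n => ?_⟩
  have hpos : 0 < ‖a + n‖ := norm_pos_iff.2 (ha n)
  rcases lt_or_ge n N with hn | hn
  · have := Finset.single_le_sum (f := fun n : ℕ => ((n : ℝ) + 1) / ‖a + n‖)
      (fun n _ => by positivity) (Finset.mem_range.2 hn)
    rw [← div_le_iff₀ hpos]
    linarith
  · have h1 : (n : ℝ) - ‖a‖ ≤ ‖a + n‖ := by
      have := norm_sub_norm_le (n : ℂ) (-a)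
      rw [norm_neg, Complex.norm_natCast, sub_neg_eq_add, add_comm (n : ℂ)] at this
      exact this
    have h2 : (N : ℝ) ≤ n := by exact_mod_cast hn
    nlinarith [norm_nonneg a, mul_nonneg hs hpos.le]

theorem exists_factorial_le_norm_ascPochhammer {a : ℂ} (ha : ∀ n : ℕ, a + n ≠ 0) :
    ∃ κ : ℝ, 1 ≤ κ ∧ ∀ n : ℕ, ‖(ascPochhammer ℂ n).eval a‖⁻¹ ≤ κ ^ n / n.factorial := by
  obtain ⟨κ, hκ, h⟩ := exists_natCast_add_one_le_norm_add ha
  refine ⟨κ, hκ, fun n => ?_⟩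
  have hpos := norm_pos_iff.2 (ascPochhammer_eval_ne_zero ha n)
  rw [inv_le_iff_one_le_mul₀ hpos, div_mul_eq_mul_div, le_div_iff₀ (by positivity), one_mul]
  clear hpos
  induction n with
  | zero => simp
  | succ n ih =>
    rw [ascPochhammer_eval_succ_right', norm_mul, Nat.factorial_succ, pow_succ]
    push_cast
    calc ((n : ℝ) + 1) * n.factorial ≤ (κ * ‖a + n‖) *
          (κ ^ n * ‖(ascPochhammer ℂ n).eval a‖) := by
          gcongr
          exact h n
      _ = _ := by ring

theorem factorial_add_le_two_pow_mul (n k : ℕ) : ((n + k).factorial : ℝ) ≤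
    2 ^ (n + k) * n.factorial * k.factorial := by
  have h1 := Nat.add_choose_mul_factorial_mul_factorial n k
  have h2 := Nat.choose_le_two_pow (n + k) k
  have h3 : (n + k).factorial ≤ 2 ^ (n + k) * n.factorial * k.factorial := by
    rw [← h1]; gcongr
  exact_mod_cast h3

/-- Up to geometric factors `(c)_n` is at most `n!`, `(b)_{m+n}` is at most `(m+n)!`, and `1/(d)_m`
is at most `1/m!`. It remains to bound `(a)_{m-n} (m+n)!` by `m!²`, which is `key`. -/
theorem geomBound_hornCoeff {a d : ℂ} (ha : ∀ n : ℕ, 1 - a + n ≠ 0) (hd : ∀ n : ℕ, d + n ≠ 0)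
    (b c : ℂ) : ∃ K : ℝ, 1 ≤ K ∧ GeomBound (hornCoeff a b c d) K := by
  obtain ⟨κ, hκ, hκ'⟩ := exists_factorial_le_norm_ascPochhammer ha
  obtain ⟨μ, hμ, hμ'⟩ := exists_factorial_le_norm_ascPochhammer hd
  set L := (‖a‖ + 1) * κ with hL
  have hL1 : ‖a‖ + 1 ≤ L := by nlinarith [norm_nonneg a]
  have hL2 : κ ≤ L := by nlinarith [norm_nonneg a]
  have hL3 : 1 ≤ L := hκ.trans hL2
  clear_value L
  have hb1 : 1 ≤ ‖b‖ + 1 := by linarith [norm_nonneg b]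
  have hc1 : 1 ≤ ‖c‖ + 1 := by linarith [norm_nonneg c]
  have key : ∀ m n : ℕ, ‖intPochhammer a ((m : ℤ) - n)‖ * (m + n).factorial ≤
      (4 * L) ^ (m + n) * (m.factorial * m.factorial) := by
    intro m n
    -- For `m = n + k`, `(a)_k` is bounded by `k!` and `k! n! ≤ m!`. For `n = m + k`, `(a)_{-k}` is
    -- of size `1/k!` and absorbs the `k!` produced by splitting `n!`. In both cases binomial
    -- coefficients are bounded by powers of `2`.
    rcases le_total n m with h | h
    · obtain ⟨k, rfl⟩ := Nat.exists_eq_add_of_le h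
      have e : ((n + k : ℕ) : ℤ) - (n : ℤ) = (k : ℕ) := by push_cast; ring
      rw [e, intPochhammer_natCast]
      have h1 := norm_ascPochhammer_eval_le a k
      have h2 := factorial_add_le_two_pow_mul (n + k) n
      have h3 : (k.factorial : ℝ) * n.factorial ≤ (n + k).factorial := by
        have := Nat.le_of_dvd (Nat.factorial_pos _) (Nat.factorial_mul_factorial_dvd_factorial_add n k)
        rw [mul_comm]
        exact_mod_cast this
      calc _ ≤ ((‖a‖ + 1) ^ k * k.factorial) * (2 ^ (n + k + n) * (n + k).factorial * n.factorial) := by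
            gcongr
        _ = (‖a‖ + 1) ^ k * 2 ^ (n + k + n) * (n + k).factorial * (k.factorial * n.factorial) := by
            ring
        _ ≤ L ^ k * 4 ^ (n + k + n) * (n + k).factorial * (n + k).factorial := by
            gcongr
            norm_num
        _ ≤ L ^ (n + k + n) * 4 ^ (n + k + n) * (n + k).factorial * (n + k).factorial := by
            gcongr
            · omega
        _ = _ := by rw [mul_pow 4 L]; ring
    · obtain ⟨k, rfl⟩ := Nat.exists_eq_add_of_le h
      have e : (m : ℤ) - ((m + k : ℕ) : ℤ) = -(k : ℤ) := by push_cast; ring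
      rw [e, intPochhammer_neg_natCast, norm_inv, norm_mul, norm_pow, norm_neg, norm_one, one_pow,
        one_mul]
      have h1 := hκ' k
      have h2 := factorial_add_le_two_pow_mul m (m + k)
      have h3 := factorial_add_le_two_pow_mul m k
      calc _ ≤ (κ ^ k / k.factorial) * (2 ^ (m + (m + k)) * m.factorial *
              (2 ^ (m + k) * m.factorial * k.factorial)) := by
            gcongr
            exact h2.trans (by gcongr)
        _ = κ ^ k * 2 ^ (m + (m + k)) * 2 ^ (m + k) * m.factorial * m.factorial := by
            field_simp
        _ ≤ L ^ (m + (m + k)) * 2 ^ (m + (m + k)) * 2 ^ (m + (m + k)) * m.factorial * m.factorial := by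
            have : κ ^ k ≤ L ^ (m + (m + k)) :=
              (pow_le_pow_left₀ (by linarith) hL2 k).trans (pow_le_pow_right₀ hL3 (by omega))
            gcongr
            · norm_num
            · omega
        _ = _ := by
            rw [mul_pow 4 L, show (4 : ℝ) = 2 * 2 by norm_num, mul_pow 2 2]; ring
  refine ⟨4 * L * (‖b‖ + 1) * (‖c‖ + 1) * μ, ?_, 1, zero_le_one, fun m n => ?_⟩
  · have : 1 ≤ 4 * L := by linarith
    exact one_le_mul_of_one_le_of_one_le (one_le_mul_of_one_le_of_one_le
      (one_le_mul_of_one_le_of_one_le this hb1) hc1) hμ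
  · have h1 := norm_ascPochhammer_eval_le b (m + n)
    have h2 := norm_ascPochhammer_eval_le c n
    have h3 := hμ' m
    have h4 := key m n
    have h5 : (‖c‖ + 1) ^ n ≤ (‖c‖ + 1) ^ (m + n) := pow_le_pow_right₀ hc1 (by omega)
    have h6 : μ ^ m ≤ μ ^ (m + n) := pow_le_pow_right₀ hμ (by omega)
    have hm : (0 : ℝ) < m.factorial := by positivity
    have hn : (0 : ℝ) < n.factorial := by positivity
    unfold hornCoeff
    rw [norm_div, norm_mul, norm_mul, norm_mul, norm_mul, Complex.norm_natCast,
      Complex.norm_natCast, one_mul]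
    calc _ = ‖intPochhammer a ((m : ℤ) - n)‖ * ‖(ascPochhammer ℂ (m + n)).eval b‖ *
          ‖(ascPochhammer ℂ n).eval c‖ * ‖(ascPochhammer ℂ m).eval d‖⁻¹ *
            ((m.factorial : ℝ)⁻¹ * (n.factorial : ℝ)⁻¹) := by
          rw [div_eq_mul_inv, mul_inv, mul_inv]; ring
      _ ≤ ‖intPochhammer a ((m : ℤ) - n)‖ * ((‖b‖ + 1) ^ (m + n) * (m + n).factorial) *
          ((‖c‖ + 1) ^ n * n.factorial) * (μ ^ m / m.factorial) *
            ((m.factorial : ℝ)⁻¹ * (n.factorial : ℝ)⁻¹) := by gcongr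
      _ = (‖intPochhammer a ((m : ℤ) - n)‖ * (m + n).factorial) *
          ((‖b‖ + 1) ^ (m + n) * (‖c‖ + 1) ^ n * μ ^ m) *
            ((m.factorial : ℝ)⁻¹ * (m.factorial : ℝ)⁻¹) := by
          field_simp
      _ ≤ ((4 * L) ^ (m + n) * (m.factorial * m.factorial)) *
          ((‖b‖ + 1) ^ (m + n) * (‖c‖ + 1) ^ (m + n) * μ ^ (m + n)) *
            ((m.factorial : ℝ)⁻¹ * (m.factorial : ℝ)⁻¹) := by gcongr
      _ = _ := by
          simp only [mul_pow]
          field_simp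

/-! ### Partial differential equations of `H₁` and derivatives along curves -/

/-- Multiplying the coefficients by a quadratic polynomial in the indices. -/
theorem GeomBound.doubleSeries_quadratic {A : ℕ → ℕ → ℂ} {K ρ : ℝ} (h : GeomBound A K)
    (hK : 0 ≤ K) (hKρ : 4 * K * ρ < 1) {x y : ℂ} (hx : ‖x‖ ≤ ρ) (hy : ‖y‖ ≤ ρ)
    (c₂₀ c₁₁ c₀₂ c₁₀ c₀₁ c₀₀ : ℂ) :
    doubleSeries (fun m n => (c₂₀ * m ^ 2 + c₁₁ * (m * n) + c₀₂ * n ^ 2 + c₁₀ * m + c₀₁ * n + c₀₀) *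
        A m n) x y =
      c₂₀ * doubleSeries (fun m n => (m : ℂ) * ((m : ℂ) * A m n)) x y +
      c₁₁ * doubleSeries (fun m n => (n : ℂ) * ((m : ℂ) * A m n)) x y +
      c₀₂ * doubleSeries (fun m n => (n : ℂ) * ((n : ℂ) * A m n)) x y +
      c₁₀ * doubleSeries (fun m n => (m : ℂ) * A m n) x y +
      c₀₁ * doubleSeries (fun m n => (n : ℂ) * A m n) x y + c₀₀ * doubleSeries A x y := by
  have hρ : 0 ≤ ρ := (norm_nonneg x).trans hx
  have hKρ0 : 0 ≤ K * ρ := mul_nonneg hK hρ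
  have h2 : 2 * K * ρ < 1 := by nlinarith
  have h4 : 2 * (2 * K) * ρ < 1 := by nlinarith
  have h1 : K * ρ < 1 := by nlinarith
  have s20 := (h.natCast_fst_mul.natCast_fst_mul.summable (by positivity) h4 hx hy).hasSum
  have s11 := (h.natCast_fst_mul.natCast_snd_mul.summable (by positivity) h4 hx hy).hasSum
  have s02 := (h.natCast_snd_mul.natCast_snd_mul.summable (by positivity) h4 hx hy).hasSum
  have s10 := (h.natCast_fst_mul.summable (by positivity) h2 hx hy).hasSum
  have s01 := (h.natCast_snd_mul.summable (by positivity) h2 hx hy).hasSum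
  have s00 := (h.summable hK h1 hx hy).hasSum
  refine HasSum.tsum_eq ((((((s20.mul_left c₂₀).add (s11.mul_left c₁₁)).add
    (s02.mul_left c₀₂)).add (s10.mul_left c₁₀)).add (s01.mul_left c₀₁)).add
    (s00.mul_left c₀₀) |>.congr_fun fun p => ?_)
  ring

theorem doubleSeries_congr {A B : ℕ → ℕ → ℂ} (h : ∀ m n, A m n = B m n) (x y : ℂ) :
    doubleSeries A x y = doubleSeries B x y :=
  tsum_congr fun p => by rw [h]

/-- The first partial differential equation of Horn's function `H₁`. -/
theorem hornH1_pde_fst {a b c d : ℂ} (ha : ∀ n : ℕ, 1 - a + n ≠ 0) (hd : ∀ n : ℕ, d + n ≠ 0)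
    {K ρ : ℝ} (h : GeomBound (hornCoeff a b c d) K) (hK : 0 ≤ K) (hKρ : 4 * K * ρ < 1) {x y : ℂ}
    (hx : ‖x‖ ≤ ρ) (hy : ‖y‖ ≤ ρ) :
    doubleSeries (fun m n => (m : ℂ) * ((m : ℂ) * hornCoeff a b c d m n)) x y +
        (d - 1) * doubleSeries (fun m n => (m : ℂ) * hornCoeff a b c d m n) x y =
      x * (doubleSeries (fun m n => (m : ℂ) * ((m : ℂ) * hornCoeff a b c d m n)) x y -
        doubleSeries (fun m n => (n : ℂ) * ((n : ℂ) * hornCoeff a b c d m n)) x y +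
        (a + b) * doubleSeries (fun m n => (m : ℂ) * hornCoeff a b c d m n) x y +
        (a - b) * doubleSeries (fun m n => (n : ℂ) * hornCoeff a b c d m n) x y +
        a * b * doubleSeries (hornCoeff a b c d) x y) := by
  have h1 := h.doubleSeries_quadratic hK hKρ hx hy 1 0 0 (d - 1) 0 0
  -- These are the coefficients of `(a + m - n)(b + m + n)` expanded in `m` and `n`; `h1` encodes `m
  -- (m + d - 1)`, which vanishes at `m = 0`.
  have h2 := h.doubleSeries_quadratic hK hKρ hx hy 1 0 (-1) (a + b) (a - b) (a * b)
  have h3 := doubleSeries_shift_fst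
    (A := fun m n : ℕ => (1 * (m : ℂ) ^ 2 + 0 * (m * n) + 0 * (n : ℂ) ^ 2 + (d - 1) * m + 0 * n + 0) *
      hornCoeff a b c d m n)
    (B := fun m n : ℕ => (1 * (m : ℂ) ^ 2 + 0 * (m * n) + -1 * (n : ℂ) ^ 2 + (a + b) * m +
      (a - b) * n + a * b) * hornCoeff a b c d m n) (fun n => by simp) (fun m n => by
        have := hornCoeff_succ_fst ha hd b c m n
        push_cast
        linear_combination this) x y
  rw [h1, h2] at h3
  linear_combination h3

/-- The second partial differential equation of Horn's function `H₁`. -/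
theorem hornH1_pde_snd {a d : ℂ} (ha : ∀ n : ℕ, 1 - a + n ≠ 0) {b c : ℂ}
    {K ρ : ℝ} (h : GeomBound (hornCoeff a b c d) K) (hK : 0 ≤ K) (hKρ : 4 * K * ρ < 1) {x y : ℂ}
    (hx : ‖x‖ ≤ ρ) (hy : ‖y‖ ≤ ρ) :
    doubleSeries (fun m n => (n : ℂ) * ((m : ℂ) * hornCoeff a b c d m n)) x y -
        doubleSeries (fun m n => (n : ℂ) * ((n : ℂ) * hornCoeff a b c d m n)) x y +
        a * doubleSeries (fun m n => (n : ℂ) * hornCoeff a b c d m n) x y =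
      y * (doubleSeries (fun m n => (n : ℂ) * ((m : ℂ) * hornCoeff a b c d m n)) x y +
        doubleSeries (fun m n => (n : ℂ) * ((n : ℂ) * hornCoeff a b c d m n)) x y +
        c * doubleSeries (fun m n => (m : ℂ) * hornCoeff a b c d m n) x y +
        (b + c) * doubleSeries (fun m n => (n : ℂ) * hornCoeff a b c d m n) x y +
        b * c * doubleSeries (hornCoeff a b c d) x y) := by
  have h1 := h.doubleSeries_quadratic hK hKρ hx hy 0 1 (-1) 0 a 0
  -- The expansion of `(b + m + n)(c + n)`, against `n (a + m - n)` in `h1`.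
  have h2 := h.doubleSeries_quadratic hK hKρ hx hy 0 1 1 c (b + c) (b * c)
  have h3 := doubleSeries_shift_snd
    (A := fun m n : ℕ => (0 * (m : ℂ) ^ 2 + 1 * (m * n) + -1 * (n : ℂ) ^ 2 + 0 * m + a * n + 0) *
      hornCoeff a b c d m n)
    (B := fun m n : ℕ => (0 * (m : ℂ) ^ 2 + 1 * (m * n) + 1 * (n : ℂ) ^ 2 + c * m +
      (b + c) * n + b * c) * hornCoeff a b c d m n) (fun n => by simp) (fun m n => by
        have := hornCoeff_succ_snd ha b c d m n
        push_cast
        linear_combination this) x y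
  rw [h1, h2] at h3
  linear_combination h3

/-- Second derivative of a double series along a curve with logarithmic derivatives `ξ`, `η`. -/
theorem GeomBound.hasDerivAt_hasDerivAt {A : ℕ → ℕ → ℂ} {K ρ : ℝ} (h : GeomBound A K) (hK : 0 ≤ K)
    (hρ : 0 ≤ ρ) (hKρ : 4 * K * ρ < 1) {U : Set ℂ} (hU : IsOpen U) {x y ξ η ξ' η' : ℂ → ℂ}
    (hx : ∀ s ∈ U, HasDerivAt x (ξ s * x s) s) (hy : ∀ s ∈ U, HasDerivAt y (η s * y s) s)
    (hξ : ∀ s ∈ U, HasDerivAt ξ (ξ' s) s) (hη : ∀ s ∈ U, HasDerivAt η (η' s) s)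
    (hxρ : ∀ s ∈ U, ‖x s‖ ≤ ρ) (hyρ : ∀ s ∈ U, ‖y s‖ ≤ ρ) {s : ℂ} (hs : s ∈ U) :
    HasDerivAt (fun s => doubleSeries A (x s) (y s))
      (ξ s * doubleSeries (fun m n => (m : ℂ) * A m n) (x s) (y s) +
        η s * doubleSeries (fun m n => (n : ℂ) * A m n) (x s) (y s)) s ∧
    HasDerivAt (fun s => ξ s * doubleSeries (fun m n => (m : ℂ) * A m n) (x s) (y s) +
        η s * doubleSeries (fun m n => (n : ℂ) * A m n) (x s) (y s))
      (ξ' s * doubleSeries (fun m n => (m : ℂ) * A m n) (x s) (y s) +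
        η' s * doubleSeries (fun m n => (n : ℂ) * A m n) (x s) (y s) +
        ξ s ^ 2 * doubleSeries (fun m n => (m : ℂ) * ((m : ℂ) * A m n)) (x s) (y s) +
        2 * ξ s * η s * doubleSeries (fun m n => (n : ℂ) * ((m : ℂ) * A m n)) (x s) (y s) +
        η s ^ 2 * doubleSeries (fun m n => (n : ℂ) * ((n : ℂ) * A m n)) (x s) (y s)) s := by
  have hKρ0 : 0 ≤ K * ρ := mul_nonneg hK hρ
  have h2 : 2 * K * ρ < 1 := by nlinarith
  have h4 : 2 * (2 * K) * ρ < 1 := by nlinarith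
  have hK2 : 0 ≤ 2 * K := by positivity
  refine ⟨h.hasDerivAt hK hρ h2 hU hx hy hxρ hyρ hs, ?_⟩
  have d1 := h.natCast_fst_mul.hasDerivAt hK2 hρ h4 hU hx hy hxρ hyρ hs
  have d2 := h.natCast_snd_mul.hasDerivAt hK2 hρ h4 hU hx hy hxρ hyρ hs
  refine (((hξ s hs).fun_mul d1).fun_add ((hη s hs).fun_mul d2)).congr_deriv ?_
  have e := doubleSeries_congr (A := fun m n => (m : ℂ) * ((n : ℂ) * A m n))
    (B := fun m n => (n : ℂ) * ((m : ℂ) * A m n)) (fun m n => by ring) (x s) (y s)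
  rw [e]
  ring

/-! ### The quartic equation and uniqueness of its holomorphic solution -/

/-- `f` solves `(1 - s⁴) f'' - 8 p s³ f' - 4 p (4 p - 1) s² f = 0` at `s`, which is the pullback of
the hypergeometric equation with parameters `p, p - 1/4; 2 p` along `s ↦ 1 - s⁴`. -/
def QuarticODE (p : ℂ) (f : ℂ → ℂ) (s : ℂ) : Prop :=
  (1 - s ^ 4) * deriv (deriv f) s - 8 * p * s ^ 3 * deriv f s - 4 * p * (4 * p - 1) * s ^ 2 * f s = 0

theorem QuarticODE.of_hasDerivAt {p : ℂ} {f f' f'' : ℂ → ℂ} {U : Set ℂ} (hU : IsOpen U)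
    (h1 : ∀ s ∈ U, HasDerivAt f (f' s) s) (h2 : ∀ s ∈ U, HasDerivAt f' (f'' s) s) {s : ℂ}
    (hs : s ∈ U)
    (h : (1 - s ^ 4) * f'' s - 8 * p * s ^ 3 * f' s - 4 * p * (4 * p - 1) * s ^ 2 * f s = 0) :
    QuarticODE p f s := by
  have e : deriv f =ᶠ[𝓝 s] f' := by
    filter_upwards [hU.mem_nhds hs] with z hz using (h1 z hz).deriv
  rw [QuarticODE, e.deriv_eq, (h2 s hs).deriv, (h1 s hs).deriv]
  exact h

theorem QuarticODE.sub_const_mul {p c : ℂ} {f g : ℂ → ℂ} {s : ℂ} (hf : AnalyticAt ℂ f s)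
    (hg : AnalyticAt ℂ g s) (h1 : QuarticODE p f s) (h2 : QuarticODE p g s) :
    QuarticODE p (fun s => f s - c * g s) s := by
  have e1 : ∀ᶠ z in 𝓝 s, deriv (fun s => f s - c * g s) z = deriv f z - c * deriv g z := by
    filter_upwards [hf.eventually_analyticAt, hg.eventually_analyticAt] with z hz1 hz2
    exact (hz1.differentiableAt.hasDerivAt.fun_sub
      (hz2.differentiableAt.hasDerivAt.const_mul c)).deriv
  have e2 : deriv (deriv fun s => f s - c * g s) s = deriv (deriv f) s - c * deriv (deriv g) s := by
    rw [EventuallyEq.deriv_eq e1]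
    exact (hf.deriv.differentiableAt.hasDerivAt.fun_sub
      (hg.deriv.differentiableAt.hasDerivAt.const_mul c)).deriv
  unfold QuarticODE at *
  rw [e2, e1.self_of_nhds]
  linear_combination h1 - c * h2

/-- A holomorphic solution that vanishes at a fourth root of unity vanishes identically. -/
theorem QuarticODE.eventually_eq_zero {p : ℂ} (hp : ∀ n : ℕ, 2 * p ≠ -(n : ℂ)) {f : ℂ → ℂ} {s₀ : ℂ}
    (hs₀ : s₀ ^ 4 = 1) (hf : AnalyticAt ℂ f s₀) (hf₀ : f s₀ = 0)
    (h : ∀ᶠ s in 𝓝[≠] s₀, QuarticODE p f s) : ∀ᶠ s in 𝓝 s₀, f s = 0 := by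
  by_contra hne
  -- A nonzero solution would be `(s - s₀)^(j+1) g` with `g s₀ ≠ 0`. The leading coefficient of the
  -- equation then forces the exponent `j + 1` to equal `1 - 2p`, i.e. `2p = -j`.
  obtain ⟨k, g, hg, hg₀, hfg⟩ := hf.exists_eventuallyEq_pow_smul_nonzero_iff.2 hne
  have hs₀' : s₀ ≠ 0 := by rintro rfl; norm_num at hs₀
  rcases k with _ | j
  · have := hfg.self_of_nhds
    simp [hf₀] at this
    exact hg₀ this.symm
  have e0 : ∀ s, HasDerivAt (fun s : ℂ => (s - s₀) ^ (j + 1)) ((j + 1) * (s - s₀) ^ j) s := fun s => by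
    refine (((hasDerivAt_id s).sub_const s₀).fun_pow (j + 1)).congr_deriv ?_
    simp
  have e0' : ∀ s, HasDerivAt (fun s : ℂ => (s - s₀) ^ j) (j * (s - s₀) ^ (j - 1)) s := fun s => by
    refine (((hasDerivAt_id s).sub_const s₀).fun_pow j).congr_deriv ?_
    simp
  have d1 : ∀ᶠ s in 𝓝 s₀, deriv f s = (j + 1) * (s - s₀) ^ j * g s + (s - s₀) ^ (j + 1) * deriv g s := by
    filter_upwards [hfg.eventually_nhds, hg.eventually_analyticAt] with s hs hgs
    rw [EventuallyEq.deriv_eq hs]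
    exact ((e0 s).fun_mul hgs.differentiableAt.hasDerivAt).deriv
  have d2 : ∀ᶠ s in 𝓝 s₀, deriv (deriv f) s =
      (j + 1) * (j * (s - s₀) ^ (j - 1)) * g s + 2 * (j + 1) * (s - s₀) ^ j * deriv g s +
        (s - s₀) ^ (j + 1) * deriv (deriv g) s := by
    filter_upwards [d1.eventually_nhds, hg.eventually_analyticAt] with s hs hgs
    rw [EventuallyEq.deriv_eq hs]
    refine (((((e0' s).const_mul ((j : ℂ) + 1)).fun_mul hgs.differentiableAt.hasDerivAt).fun_add
      ((e0 s).fun_mul hgs.deriv.differentiableAt.hasDerivAt)).congr_deriv ?_).deriv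
    ring
  set Q : ℂ → ℂ := fun s => -(s ^ 3 + s ^ 2 * s₀ + s * s₀ ^ 2 + s₀ ^ 3) with hQ
  -- `G` is the left side of the equation divided by `(s - s₀)^j`, using `1 - s⁴ = (s - s₀) Q s`. It
  -- vanishes off `s₀` and is continuous, hence vanishes at `s₀` too.
  set G : ℂ → ℂ := fun s => Q s * ((j + 1) * j * g s + 2 * (j + 1) * (s - s₀) * deriv g s +
    (s - s₀) ^ 2 * deriv (deriv g) s) - 8 * p * s ^ 3 * ((j + 1) * g s + (s - s₀) * deriv g s) -
    4 * p * (4 * p - 1) * s ^ 2 * ((s - s₀) * g s) with hG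
  have hG0 : ∀ᶠ s in 𝓝[≠] s₀, G s = 0 := by
    filter_upwards [h, d1.filter_mono nhdsWithin_le_nhds, d2.filter_mono nhdsWithin_le_nhds,
      hfg.filter_mono nhdsWithin_le_nhds, self_mem_nhdsWithin] with s hs h1 h2 h0 hne
    have hne' : s - s₀ ≠ 0 := sub_ne_zero.2 hne
    rw [QuarticODE, h2, h1, h0, smul_eq_mul] at hs
    have hQs : 1 - s ^ 4 = (s - s₀) * Q s := by
      simp only [hQ]
      linear_combination -hs₀
    have hj : (s - s₀) * ((j : ℂ) * (s - s₀) ^ (j - 1)) = j * (s - s₀) ^ j := by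
      rcases j with _ | j
      · simp
      · simp only [Nat.add_sub_cancel]; ring
    have : (s - s₀) ^ j * G s = 0 := by
      rw [← hs, hQs]
      simp only [hG]
      linear_combination (-(Q s) * (j + 1) * g s) * hj
    exact (mul_eq_zero.1 this).resolve_left (pow_ne_zero _ hne')
  have hGc : ContinuousAt G s₀ := by
    have c1 := hg.continuousAt
    have c2 := hg.deriv.continuousAt
    have c3 := hg.deriv.deriv.continuousAt
    simp only [hG, hQ]
    fun_prop
  have hG1 : G s₀ = 0 := by
    have t1 : Tendsto G (𝓝[≠] s₀) (𝓝 (G s₀)) := hGc.tendsto.mono_left nhdsWithin_le_nhds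
    have t2 : Tendsto G (𝓝[≠] s₀) (𝓝 0) :=
      tendsto_const_nhds.congr' (hG0.mono fun s hs => hs.symm)
    exact tendsto_nhds_unique t1 t2
  have h5 : (-4 * s₀ ^ 3 * (j + 1) * g s₀) * (2 * p + j) = 0 := by
    rw [← hG1]
    simp only [hG, hQ]
    ring
  have h6 : (-4 * s₀ ^ 3 * ((j : ℂ) + 1) * g s₀) ≠ 0 := by
    have : (j : ℂ) + 1 ≠ 0 := by exact_mod_cast j.succ_ne_zero
    have := pow_ne_zero 3 hs₀'
    simp_all
  exact hp j (eq_neg_of_add_eq_zero_left ((mul_eq_zero.1 h5).resolve_left h6))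

/-- Uniqueness, up to scaling, of the holomorphic solution at a fourth root of unity. -/
theorem QuarticODE.eqOn_const_mul {p : ℂ} (hp : ∀ n : ℕ, 2 * p ≠ -(n : ℂ)) {f g : ℂ → ℂ} {s₀ : ℂ}
    (hs₀ : s₀ ^ 4 = 1) {U : Set ℂ} (hU : IsOpen U) (hUc : IsPreconnected U) (hsU : s₀ ∈ U)
    (hf : DifferentiableOn ℂ f U) (hg : DifferentiableOn ℂ g U) (hg₀ : g s₀ = 1)
    (hfo : ∀ᶠ s in 𝓝[≠] s₀, QuarticODE p f s) (hgo : ∀ᶠ s in 𝓝[≠] s₀, QuarticODE p g s) :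
    ∀ s ∈ U, f s = f s₀ * g s := by
  have hfa := hf.analyticOnNhd hU
  have hga := hg.analyticOnNhd hU
  have hev : ∀ᶠ s in 𝓝 s₀, f s - f s₀ * g s = 0 := by
    refine QuarticODE.eventually_eq_zero hp hs₀ ((hfa s₀ hsU).sub
      (analyticAt_const.mul (hga s₀ hsU))) (by simp [hg₀]) ?_
    filter_upwards [hfo, hgo, nhdsWithin_le_nhds (hU.mem_nhds hsU)] with s h1 h2 hs
    exact QuarticODE.sub_const_mul (hfa s hs) (hga s hs) h1 h2
  exact hfa.eqOn_of_preconnected_of_eventuallyEq (analyticOnNhd_const.mul hga) hUc hsU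
    (hev.mono fun s hs => sub_eq_zero.1 hs)

/-! ### The Gauss function as a solution of the quartic equation -/

/-- Lets the Gauss function inherit bounds, derivatives and its differential equation from Horn's
series. The choice `c = 0` is immaterial, since `y = 0` already removes every term with `n ≥ 1`. -/
theorem ordinaryHypergeometric_eq_doubleSeries (a b d z : ℂ) :
    ₂F₁ a b d z = doubleSeries (hornCoeff a b 0 d) z 0 := by
  rw [ordinaryHypergeometric_eq_tsum]
  unfold doubleSeries
  have hi : Function.Injective fun n : ℕ => (n, 0) := fun m n h => by simpa using h
  rw [← hi.tsum_eq]
  · refine tsum_congr fun n => ?_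
    have : hornCoeff a b 0 d n 0 = (ascPochhammer ℂ n).eval a * (ascPochhammer ℂ n).eval b /
        ((ascPochhammer ℂ n).eval d * n.factorial) := by
      simp [hornCoeff, intPochhammer]
    rw [smul_eq_mul, this, pow_zero, mul_one, div_eq_mul_inv, mul_inv]
    ring
  · rintro ⟨m, n⟩ hp
    rcases n with _ | n
    · exact ⟨m, rfl⟩
    · simp at hp

/-- The Gauss function `₂F₁(p, p - 1/4; 2 p; z)` is holomorphic near `0` and its pullback along
`z = 1 - s⁴` satisfies `QuarticODE`. -/
theorem exists_gauss_quarticODE {p : ℂ} (h1 : ∀ n : ℕ, 2 * p ≠ -(n : ℂ))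
    (h2 : ∀ n : ℕ, 2 - 2 * p ≠ -(n : ℂ)) :
    ∃ ρ : ℝ, 0 < ρ ∧ DifferentiableOn ℂ (₂F₁ p (p - 1 / 4) (2 * p)) (Metric.ball (0 : ℂ) ρ) ∧
      ∀ s : ℂ, ‖1 - s ^ 4‖ < ρ → s ^ 4 ≠ 1 →
        QuarticODE p (fun s => ₂F₁ p (p - 1 / 4) (2 * p) (1 - s ^ 4)) s := by
  have ha : ∀ n : ℕ, 1 - p + n ≠ 0 := fun n h => h2 (2 * n) (by
    push_cast; linear_combination 2 * h)
  have hd : ∀ n : ℕ, 2 * p + n ≠ 0 := fun n h => h1 n (eq_neg_of_add_eq_zero_left h)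
  obtain ⟨K, hK1, hK⟩ := geomBound_hornCoeff ha hd (p - 1 / 4) 0
  have hK0 : 0 < K := by linarith
  -- This radius gives `4Kρ = 1/2`, leaving room for two Euler operators.
  have hρ : 0 < 1 / (8 * K) := by positivity
  have hKρ : 4 * K * (1 / (8 * K)) < 1 := by field_simp; norm_num
  have e : (₂F₁ p (p - 1 / 4) (2 * p) : ℂ → ℂ) =
      fun z => doubleSeries (hornCoeff p (p - 1 / 4) 0 (2 * p)) z 0 :=
    funext fun z => ordinaryHypergeometric_eq_doubleSeries _ _ _ _
  refine ⟨1 / (8 * K), hρ, ?_, ?_⟩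
  · rw [e]
    refine hK.differentiableOn hK0.le hρ.le (by nlinarith) Metric.isOpen_ball differentiableOn_id
      (differentiableOn_const 0) (fun s hs => ?_) (fun s _ => by simpa using hρ.le)
    simpa using (mem_ball_zero_iff.1 hs).le
  · intro s hs hs4
    rw [e]
    -- The roots of unity are removed because the logarithmic derivative of `1 - s⁴` has poles
    -- there; the uniqueness lemma only asks for the equation on a punctured neighbourhood.
    set U : Set ℂ := {s | ‖1 - s ^ 4‖ < 1 / (8 * K) ∧ s ^ 4 ≠ 1} with hUdef
    have hU : IsOpen U := by
      rw [hUdef, Set.ofPred_and]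
      exact (isOpen_lt (by fun_prop) (by fun_prop)).inter (isOpen_ne_fun (by fun_prop) (by fun_prop))
    have hne : ∀ s ∈ U, 1 - s ^ 4 ≠ 0 := fun s hs => sub_ne_zero.2 hs.2.symm
    have hx4 : ∀ s : ℂ, HasDerivAt (fun s : ℂ => 1 - s ^ 4) (-4 * s ^ 3) s := fun s => by
      refine ((hasDerivAt_pow 4 s).const_sub 1).congr_deriv ?_
      push_cast; ring
    have hd2 := fun s (hs : s ∈ U) => hK.hasDerivAt_hasDerivAt hK0.le hρ.le hKρ hU
      (x := fun s => 1 - s ^ 4) (y := fun _ => 0) (ξ := fun s => -4 * s ^ 3 / (1 - s ^ 4))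
      (η := fun _ => 0) (η' := fun _ => 0)
      (ξ' := fun s => (-12 * s ^ 2 * (1 - s ^ 4) - -4 * s ^ 3 * (-4 * s ^ 3)) / (1 - s ^ 4) ^ 2)
      (fun s hs => (hx4 s).congr_deriv (by have := hne s hs; field_simp))
      (fun s _ => (hasDerivAt_const s (0 : ℂ)).congr_deriv (by simp))
      (fun s hs => by
        refine ((((hasDerivAt_pow 3 s).const_mul (-4 : ℂ)).fun_div (hx4 s) (hne s hs))).congr_deriv ?_
        push_cast; ring)
      (fun s _ => hasDerivAt_const s 0) (fun s hs => hs.1.le) (fun s _ => by simpa using hρ.le) hs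
    refine QuarticODE.of_hasDerivAt hU (fun s hs => (hd2 s hs).1) (fun s hs => (hd2 s hs).2)
      ⟨hs, hs4⟩ ?_
    have hpde := hornH1_pde_fst ha hd hK hK0.le hKρ (x := 1 - s ^ 4) (y := 0) hs.le
      (by simpa using hρ.le)
    rw [doubleSeries_zero_right (A := fun m n => (n : ℂ) * ((n : ℂ) *
      hornCoeff p (p - 1 / 4) 0 (2 * p) m n)) (by simp),
      doubleSeries_zero_right (A := fun m n => (n : ℂ) *
      hornCoeff p (p - 1 / 4) 0 (2 * p) m n) (by simp)] at hpde
    have hne' := hne s ⟨hs, hs4⟩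
    simp only [zero_mul, mul_zero, add_zero, ne_eq, OfNat.ofNat_ne_zero, not_false_eq_true,
      zero_pow] at hpde ⊢
    have c20 : (1 - s ^ 4) * (-4 * s ^ 3 / (1 - s ^ 4)) ^ 2 =
        16 * s ^ 2 / (1 - s ^ 4) * (1 - (1 - s ^ 4)) := by
      field_simp
      ring
    have c10 : (1 - s ^ 4) * ((-12 * s ^ 2 * (1 - s ^ 4) - -4 * s ^ 3 * (-4 * s ^ 3)) /
        (1 - s ^ 4) ^ 2) - 8 * p * s ^ 3 * (-4 * s ^ 3 / (1 - s ^ 4)) =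
        16 * s ^ 2 / (1 - s ^ 4) * (2 * p - 1 - (1 - s ^ 4) * (p + (p - 1 / 4))) := by
      field_simp
      ring
    have c00 : -(4 * p * (4 * p - 1) * s ^ 2) =
        -(16 * s ^ 2 / (1 - s ^ 4) * ((1 - s ^ 4) * (p * (p - 1 / 4)))) := by
      field_simp
      ring
    generalize doubleSeries (hornCoeff p (p - 1 / 4) 0 (2 * p)) (1 - s ^ 4) 0 = S00 at *
    generalize doubleSeries (fun m n => (m : ℂ) * hornCoeff p (p - 1 / 4) 0 (2 * p) m n)
      (1 - s ^ 4) 0 = S10 at *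
    generalize doubleSeries (fun m n => (m : ℂ) * ((m : ℂ) *
      hornCoeff p (p - 1 / 4) 0 (2 * p) m n)) (1 - s ^ 4) 0 = S20 at *
    linear_combination 16 * s ^ 2 / (1 - s ^ 4) * hpde + S20 * c20 + S10 * c10 + S00 * c00

/-! ### Horn's function restricted to the curves of `φ` -/

/-- Dividing by a nonvanishing factor with logarithmic derivative `ω`. -/
theorem QuarticODE.div_of_hasDerivAt {p : ℂ} {h h' h'' P ω ω' : ℂ → ℂ} {U : Set ℂ} (hU : IsOpen U)
    (h1 : ∀ s ∈ U, HasDerivAt h (h' s) s) (h2 : ∀ s ∈ U, HasDerivAt h' (h'' s) s)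
    (hP : ∀ s ∈ U, HasDerivAt P (ω s * P s) s) (hP0 : ∀ s ∈ U, P s ≠ 0)
    (hω : ∀ s ∈ U, HasDerivAt ω (ω' s) s) {s : ℂ} (hs : s ∈ U)
    (H : (1 - s ^ 4) * (h'' s - 2 * ω s * h' s + (ω s ^ 2 - ω' s) * h s) -
      8 * p * s ^ 3 * (h' s - ω s * h s) - 4 * p * (4 * p - 1) * s ^ 2 * h s = 0) :
    QuarticODE p (fun s => h s / P s) s := by
  refine QuarticODE.of_hasDerivAt (f' := fun s => (h' s - ω s * h s) / P s)
    (f'' := fun s => (h'' s - 2 * ω s * h' s + (ω s ^ 2 - ω' s) * h s) / P s) hU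
    (fun s hs => ?_) (fun s hs => ?_) hs ?_
  · have := hP0 s hs
    refine ((h1 s hs).fun_div (hP s hs) this).congr_deriv ?_
    field_simp
  · have := hP0 s hs
    refine (((h2 s hs).fun_sub ((hω s hs).fun_mul (h1 s hs))).fun_div (hP s hs) this).congr_deriv ?_
    field_simp
    ring
  · have := hP0 s hs
    field_simp
    linear_combination H

/-- For fixed `t`, Horn's function along `s ↦ φ(s, t)`, divided by its prefactor, solves
`QuarticODE`. -/
theorem hornH1_hornPhi_quarticODE {q : ℂ} (h1 : ∀ n : ℕ, 2 * q ≠ -(n : ℂ))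
    (h2 : ∀ n : ℕ, 2 - 2 * q ≠ -(n : ℂ)) {K ρ : ℝ}
    (hK : GeomBound (hornCoeff (q - 1 / 2) q (1 / 2) (2 * q)) K) (hK0 : 0 ≤ K) (hρ : 0 ≤ ρ)
    (hKρ : 4 * K * ρ < 1) {t : ℂ} {U : Set ℂ} (hU : IsOpen U) {P : ℂ → ℂ}
    (hP0 : ∀ s ∈ U, P s ≠ 0)
    (hP : ∀ s ∈ U, HasDerivAt P
      ((-t - (4 * q - 1) * s * t ^ 2) / ((1 - s * t) * (1 + s * t)) * P s) s)
    (hs4 : ∀ s ∈ U, s ^ 4 ≠ 1) (hst : ∀ s ∈ U, s ^ 2 * t ^ 2 ≠ 1)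
    (hx : ∀ s ∈ U, ‖(hornPhi s t).1‖ ≤ ρ) (hy : ∀ s ∈ U, ‖(hornPhi s t).2‖ ≤ ρ) {s : ℂ}
    (hs : s ∈ U) :
    QuarticODE q (fun s => hornH1 (q - 1 / 2) q (1 / 2) (2 * q) (hornPhi s t).1 (hornPhi s t).2 /
      P s) s := by
  have ha : ∀ n : ℕ, 1 - (q - 1 / 2) + n ≠ 0 := fun n h => h2 (2 * n + 1) (by
    push_cast; linear_combination 2 * h)
  have hd : ∀ n : ℕ, 2 * q + n ≠ 0 := fun n h => h1 n (eq_neg_of_add_eq_zero_left h)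
  have n1 : ∀ s ∈ U, s ^ 4 - 1 ≠ 0 := fun s hs => sub_ne_zero.2 (hs4 s hs)
  have n2 : ∀ s ∈ U, 1 - s * t ≠ 0 := fun s hs h => hst s hs (by
    linear_combination (-1 - s * t) * h)
  have n3 : ∀ s ∈ U, 1 + s * t ≠ 0 := fun s hs h => hst s hs (by
    linear_combination (s * t - 1) * h)
  have hlin : ∀ s : ℂ, HasDerivAt (fun s : ℂ => s * t) t s := fun s => by
    simpa using (hasDerivAt_id s).mul_const t
  have dm : ∀ s : ℂ, HasDerivAt (fun s : ℂ => 1 - s * t) (-t) s := fun s =>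
    (hlin s).const_sub 1
  have dp : ∀ s : ℂ, HasDerivAt (fun s : ℂ => 1 + s * t) t s := fun s => (hlin s).const_add 1
  have d4 : ∀ s : ℂ, HasDerivAt (fun s : ℂ => s ^ 4 - 1) (4 * s ^ 3) s := fun s => by
    simpa using (hasDerivAt_pow 4 s).sub_const 1
  have dmp : ∀ s : ℂ, HasDerivAt (fun s : ℂ => (1 - s * t) * (1 + s * t)) (-2 * s * t ^ 2) s :=
    fun s => ((dm s).fun_mul (dp s)).congr_deriv (by ring)
  have hX : ∀ s, (hornPhi s t).1 = (s ^ 4 - 1) * (t ^ 4 - 1) / ((1 - s * t) * (1 + s * t)) ^ 2 :=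
    fun s => by simp only [hornPhi]; congr 1; ring
  have hY : ∀ s, (hornPhi s t).2 = ((1 + s * t) / (1 - s * t)) ^ 2 := fun s => by
    simp only [hornPhi]
    rw [← neg_sub 1 (s * t), div_neg, neg_sq, add_comm]
  set ξ : ℂ → ℂ := fun s =>
    4 * s ^ 3 / (s ^ 4 - 1) + 4 * s * t ^ 2 / ((1 - s * t) * (1 + s * t)) with hξ
  set ξ' : ℂ → ℂ := fun s => (12 * s ^ 2 * (s ^ 4 - 1) - 4 * s ^ 3 * (4 * s ^ 3)) / (s ^ 4 - 1) ^ 2 +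
    (4 * t ^ 2 * ((1 - s * t) * (1 + s * t)) - 4 * s * t ^ 2 * (-2 * s * t ^ 2)) /
      ((1 - s * t) * (1 + s * t)) ^ 2 with hξ'
  set η : ℂ → ℂ := fun s => 4 * t / ((1 - s * t) * (1 + s * t)) with hη
  set η' : ℂ → ℂ := fun s => (0 * ((1 - s * t) * (1 + s * t)) - 4 * t * (-2 * s * t ^ 2)) /
    ((1 - s * t) * (1 + s * t)) ^ 2 with hη'
  set ω : ℂ → ℂ := fun s => (-t - (4 * q - 1) * s * t ^ 2) / ((1 - s * t) * (1 + s * t)) with hω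
  set ω' : ℂ → ℂ := fun s => (-((4 * q - 1) * t ^ 2) * ((1 - s * t) * (1 + s * t)) -
    (-t - (4 * q - 1) * s * t ^ 2) * (-2 * s * t ^ 2)) / ((1 - s * t) * (1 + s * t)) ^ 2 with hω'
  have n23 : ∀ s ∈ U, (1 - s * t) * (1 + s * t) ≠ 0 := fun s hs => mul_ne_zero (n2 s hs) (n3 s hs)
  have dξ : ∀ s ∈ U, HasDerivAt ξ (ξ' s) s := fun s hs => by
    refine ((((hasDerivAt_pow 3 s).const_mul (4 : ℂ)).fun_div (d4 s) (n1 s hs)).fun_add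
      ((((hasDerivAt_id' s).const_mul (4 : ℂ)).mul_const (t ^ 2)).fun_div (dmp s)
        (n23 s hs))).congr_deriv ?_
    simp only [hξ']
    congr 2
    · push_cast; ring
    · ring
  have dη : ∀ s ∈ U, HasDerivAt η (η' s) s := fun s hs =>
    (hasDerivAt_const s (4 * t)).fun_div (dmp s) (n23 s hs)
  have dω : ∀ s ∈ U, HasDerivAt ω (ω' s) s := fun s hs => by
    refine (((((hasDerivAt_id' s).const_mul (4 * q - 1)).mul_const (t ^ 2)).const_sub (-t)).fun_div
      (dmp s) (n23 s hs)).congr_deriv ?_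
    simp only [hω']
    ring
  have dx : ∀ s ∈ U, HasDerivAt (fun s => (hornPhi s t).1) (ξ s * (hornPhi s t).1) s := by
    intro s hs
    have m1 := n1 s hs
    have m2 := n2 s hs
    have m3 := n3 s hs
    rw [hX, funext hX]
    refine (((d4 s).mul_const (t ^ 4 - 1)).fun_div ((dmp s).fun_pow 2)
      (pow_ne_zero 2 (n23 s hs))).congr_deriv ?_
    simp only [hξ]
    push_cast
    field_simp
    ring
  have dy : ∀ s ∈ U, HasDerivAt (fun s => (hornPhi s t).2) (η s * (hornPhi s t).2) s := by
    intro s hs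
    have m2 := n2 s hs
    have m3 := n3 s hs
    rw [hY, funext hY]
    refine (((dp s).fun_div (dm s) m2).fun_pow 2).congr_deriv ?_
    simp only [hη]
    push_cast
    field_simp
    ring
  have hdd := fun s (hs : s ∈ U) => hK.hasDerivAt_hasDerivAt hK0 hρ hKρ hU dx dy dξ dη hx hy hs
  refine QuarticODE.div_of_hasDerivAt (ω := ω) hU (fun s hs => (hdd s hs).1) (fun s hs => (hdd s hs).2) hP hP0
    dω hs ?_
  have E1 := hornH1_pde_fst ha hd hK hK0 hKρ (hx s hs) (hy s hs)
  have E2 := hornH1_pde_snd ha hK hK0 hKρ (hx s hs) (hy s hs)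
  generalize doubleSeries (hornCoeff (q - 1 / 2) q (1 / 2) (2 * q)) (hornPhi s t).1 (hornPhi s t).2
    = S00 at *
  generalize doubleSeries (fun m n => (m : ℂ) * hornCoeff (q - 1 / 2) q (1 / 2) (2 * q) m n)
    (hornPhi s t).1 (hornPhi s t).2 = S10 at *
  generalize doubleSeries (fun m n => (n : ℂ) * hornCoeff (q - 1 / 2) q (1 / 2) (2 * q) m n)
    (hornPhi s t).1 (hornPhi s t).2 = S01 at *
  generalize doubleSeries (fun m n => (m : ℂ) * ((m : ℂ) *
    hornCoeff (q - 1 / 2) q (1 / 2) (2 * q) m n)) (hornPhi s t).1 (hornPhi s t).2 = S20 at *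
  generalize doubleSeries (fun m n => (n : ℂ) * ((m : ℂ) *
    hornCoeff (q - 1 / 2) q (1 / 2) (2 * q) m n)) (hornPhi s t).1 (hornPhi s t).2 = S11 at *
  generalize doubleSeries (fun m n => (n : ℂ) * ((n : ℂ) *
    hornCoeff (q - 1 / 2) q (1 / 2) (2 * q) m n)) (hornPhi s t).1 (hornPhi s t).2 = S02 at *
  have m1 := n1 s hs
  have m2 := n2 s hs
  have m3 := n3 s hs
  -- The multipliers of the two partial differential equations are `λ = -16s²/(s⁴ - 1)` and `μ =
  -- -8(t² - s²)/(1 + st)²`. They are fixed by the coefficients `c20` and `c11` of the second-order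
  -- terms. That `c02` then matches as well is the special property of the curve, and `c10`, `c01`,
  -- `c00` match thanks to the logarithmic derivative `ω` of the prefactor.
  have c20 : (1 - s ^ 4) * ξ s ^ 2 = -16 * s ^ 2 / (s ^ 4 - 1) * (1 - (hornPhi s t).1) := by
    rw [hX]; simp only [hξ]; field_simp; ring
  have c11 : (1 - s ^ 4) * (2 * ξ s * η s) =
      -8 * (t ^ 2 - s ^ 2) / (1 + s * t) ^ 2 * (1 - (hornPhi s t).2) := by
    rw [hY]; simp only [hξ, hη]; field_simp; ring
  have c02 : (1 - s ^ 4) * η s ^ 2 = -16 * s ^ 2 / (s ^ 4 - 1) * (hornPhi s t).1 -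
      -8 * (t ^ 2 - s ^ 2) / (1 + s * t) ^ 2 * (1 + (hornPhi s t).2) := by
    rw [hX, hY]; simp only [hη]; field_simp; ring
  have c10 : (1 - s ^ 4) * (ξ' s - 2 * ω s * ξ s) - 8 * q * s ^ 3 * ξ s =
      -16 * s ^ 2 / (s ^ 4 - 1) * (2 * q - 1 - (hornPhi s t).1 * (q - 1 / 2 + q)) -
      -8 * (t ^ 2 - s ^ 2) / (1 + s * t) ^ 2 * ((hornPhi s t).2 * (1 / 2)) := by
    rw [hX, hY]; simp only [hξ, hξ', hω]; field_simp; ring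
  have c01 : (1 - s ^ 4) * (η' s - 2 * ω s * η s) - 8 * q * s ^ 3 * η s =
      - (-16 * s ^ 2 / (s ^ 4 - 1) * ((hornPhi s t).1 * (q - 1 / 2 - q))) +
      -8 * (t ^ 2 - s ^ 2) / (1 + s * t) ^ 2 * (q - 1 / 2 - (hornPhi s t).2 * (q + 1 / 2)) := by
    rw [hX, hY]; simp only [hη, hη', hω]; field_simp; ring
  have c00 : (1 - s ^ 4) * (ω s ^ 2 - ω' s) + 8 * q * s ^ 3 * ω s - 4 * q * (4 * q - 1) * s ^ 2 =
      - (-16 * s ^ 2 / (s ^ 4 - 1) * ((hornPhi s t).1 * ((q - 1 / 2) * q))) -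
      -8 * (t ^ 2 - s ^ 2) / (1 + s * t) ^ 2 * ((hornPhi s t).2 * (q * (1 / 2))) := by
    rw [hX, hY]; simp only [hω', hω]; field_simp; ring
  linear_combination (-16 * s ^ 2 / (s ^ 4 - 1)) * E1 +
    (-8 * (t ^ 2 - s ^ 2) / (1 + s * t) ^ 2) * E2 +
    S20 * c20 + S11 * c11 + S02 * c02 + S10 * c10 + S01 * c01 + S00 * c00

/-- On `s = -1`, Horn's function along `t ↦ φ(-1, t)`, divided by its prefactor, solves
`QuarticODE` with parameter `1 - q`. -/
theorem hornH1_hornPhi_neg_one_quarticODE {q : ℂ} (h2 : ∀ n : ℕ, 2 - 2 * q ≠ -(n : ℂ)) {K ρ : ℝ}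
    (hK : GeomBound (hornCoeff (q - 1 / 2) q (1 / 2) (2 * q)) K) (hK0 : 0 ≤ K) (hρ : 0 ≤ ρ)
    (hKρ : 4 * K * ρ < 1) {U : Set ℂ} (hU : IsOpen U) {P : ℂ → ℂ}
    (hP0 : ∀ t ∈ U, P t ≠ 0)
    (hP : ∀ t ∈ U, HasDerivAt P ((1 / (1 + t) + (1 - 2 * q) * (2 * t / (1 + t ^ 2))) * P t) t)
    (ht4 : ∀ t ∈ U, t ^ 4 ≠ 1) (hy : ∀ t ∈ U, ‖(hornPhi (-1) t).2‖ ≤ ρ) {t : ℂ} (ht : t ∈ U) :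
    QuarticODE (1 - q) (fun t => hornH1 (q - 1 / 2) q (1 / 2) (2 * q) (hornPhi (-1) t).1
      (hornPhi (-1) t).2 / P t) t := by
  have ha : ∀ n : ℕ, 1 - (q - 1 / 2) + n ≠ 0 := fun n h => h2 (2 * n + 1) (by
    push_cast; linear_combination 2 * h)
  have n1 : ∀ t ∈ U, 1 - t ≠ 0 := fun t ht h => ht4 t ht (by
    linear_combination -(1 + t) * (1 + t ^ 2) * h)
  have n2 : ∀ t ∈ U, 1 + t ≠ 0 := fun t ht h => ht4 t ht (by
    linear_combination (t - 1) * (1 + t ^ 2) * h)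
  have n3 : ∀ t ∈ U, 1 + t ^ 2 ≠ 0 := fun t ht h => ht4 t ht (by
    linear_combination (t ^ 2 - 1) * h)
  have dm : ∀ t : ℂ, HasDerivAt (fun t : ℂ => 1 - t) (-1) t := fun t =>
    (hasDerivAt_id' t).const_sub 1
  have dp : ∀ t : ℂ, HasDerivAt (fun t : ℂ => 1 + t) 1 t := fun t => (hasDerivAt_id' t).const_add 1
  have d2 : ∀ t : ℂ, HasDerivAt (fun t : ℂ => 1 + t ^ 2) (2 * t) t := fun t => by
    simpa using (hasDerivAt_pow 2 t).const_add 1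
  have hX : ∀ t, (hornPhi (-1) t).1 = 0 := fun t => by
    simp only [hornPhi]; norm_num
  have hY : ∀ t, (hornPhi (-1) t).2 = ((1 - t) / (1 + t)) ^ 2 := fun t => by
    simp only [hornPhi]
    rw [show (-1 * t + 1 : ℂ) = 1 - t by ring, show (-1 * t - 1 : ℂ) = -(1 + t) by ring, div_neg,
      neg_sq]
  set η : ℂ → ℂ := fun t => -4 / ((1 - t) * (1 + t)) with hη
  set η' : ℂ → ℂ := fun t => (0 * ((1 - t) * (1 + t)) - -4 * (-1 * (1 + t) + (1 - t) * 1)) /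
    ((1 - t) * (1 + t)) ^ 2 with hη'
  set ω : ℂ → ℂ := fun t => 1 / (1 + t) + (1 - 2 * q) * (2 * t / (1 + t ^ 2)) with hω
  set ω' : ℂ → ℂ := fun t => (0 * (1 + t) - 1 * 1) / (1 + t) ^ 2 +
    (1 - 2 * q) * ((2 * 1 * (1 + t ^ 2) - 2 * t * (2 * t)) / (1 + t ^ 2) ^ 2) with hω'
  have dη : ∀ t ∈ U, HasDerivAt η (η' t) t := fun t ht =>
    (hasDerivAt_const t (-4 : ℂ)).fun_div ((dm t).fun_mul (dp t)) (mul_ne_zero (n1 t ht) (n2 t ht))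
  have dω : ∀ t ∈ U, HasDerivAt ω (ω' t) t := fun t ht =>
    ((hasDerivAt_const t (1 : ℂ)).fun_div (dp t) (n2 t ht)).fun_add
      ((((hasDerivAt_id' t).const_mul (2 : ℂ)).fun_div (d2 t) (n3 t ht)).const_mul (1 - 2 * q))
  -- Here `x` is identically `0`, so `ξ = 0` serves as its logarithmic derivative and all series
  -- weighted by `m` vanish. The second partial differential equation alone becomes an ordinary one.
  have dx : ∀ t ∈ U, HasDerivAt (fun t => (hornPhi (-1) t).1) (0 * (hornPhi (-1) t).1) t := by
    intro t _
    rw [funext hX, zero_mul]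
    exact hasDerivAt_const t 0
  have dy : ∀ t ∈ U, HasDerivAt (fun t => (hornPhi (-1) t).2) (η t * (hornPhi (-1) t).2) t := by
    intro t ht
    have m1 := n1 t ht
    have m2 := n2 t ht
    rw [hY, funext hY]
    refine (((dm t).fun_div (dp t) m2).fun_pow 2).congr_deriv ?_
    simp only [hη]
    push_cast
    field_simp
    ring
  have hx : ∀ t ∈ U, ‖(hornPhi (-1) t).1‖ ≤ ρ := fun t _ => by simpa [hX] using hρ
  have hdd := fun t (ht : t ∈ U) => hK.hasDerivAt_hasDerivAt hK0 hρ hKρ hU (ξ := fun _ => 0)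
    (ξ' := fun _ => 0) dx dy (fun t _ => hasDerivAt_const t 0) dη hx hy ht
  refine QuarticODE.div_of_hasDerivAt (ω := ω) hU (fun t ht => (hdd t ht).1) (fun t ht => (hdd t ht).2) hP hP0
    dω ht ?_
  have E2 := hornH1_pde_snd ha hK hK0 hKρ (hx t ht) (hy t ht)
  have z11 : doubleSeries (fun m n => (n : ℂ) * ((m : ℂ) *
      hornCoeff (q - 1 / 2) q (1 / 2) (2 * q) m n)) (hornPhi (-1) t).1 (hornPhi (-1) t).2 = 0 := by
    rw [hX]; exact doubleSeries_zero_left (by simp) _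
  have z10 : doubleSeries (fun m n => (m : ℂ) *
      hornCoeff (q - 1 / 2) q (1 / 2) (2 * q) m n) (hornPhi (-1) t).1 (hornPhi (-1) t).2 = 0 := by
    rw [hX]; exact doubleSeries_zero_left (by simp) _
  rw [z10, z11] at E2
  generalize doubleSeries (hornCoeff (q - 1 / 2) q (1 / 2) (2 * q)) (hornPhi (-1) t).1
    (hornPhi (-1) t).2 = S00 at *
  generalize doubleSeries (fun m n => (n : ℂ) * hornCoeff (q - 1 / 2) q (1 / 2) (2 * q) m n)
    (hornPhi (-1) t).1 (hornPhi (-1) t).2 = S01 at *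
  generalize doubleSeries (fun m n => (n : ℂ) * ((n : ℂ) *
    hornCoeff (q - 1 / 2) q (1 / 2) (2 * q) m n)) (hornPhi (-1) t).1 (hornPhi (-1) t).2 = S02 at *
  have m1 := n1 t ht
  have m2 := n2 t ht
  have m3 := n3 t ht
  have c02 : (1 - t ^ 4) * η t ^ 2 = 8 * (1 + t) / (1 - t) * (1 + (hornPhi (-1) t).2) := by
    rw [hY]; simp only [hη]; field_simp; ring
  have c01 : (1 - t ^ 4) * (η' t - 2 * ω t * η t) - 8 * (1 - q) * t ^ 3 * η t =
      8 * (1 + t) / (1 - t) * (-(q - 1 / 2) + (hornPhi (-1) t).2 * (q + 1 / 2)) := by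
    rw [hY]; simp only [hη, hη', hω]; field_simp; ring
  have c00 : (1 - t ^ 4) * (ω t ^ 2 - ω' t) + 8 * (1 - q) * t ^ 3 * ω t -
      4 * (1 - q) * (4 * (1 - q) - 1) * t ^ 2 =
      8 * (1 + t) / (1 - t) * ((hornPhi (-1) t).2 * (q * (1 / 2))) := by
    rw [hY]; simp only [hω', hω]; field_simp; ring
  simp only [zero_mul, mul_zero, zero_add, add_zero, ne_eq, OfNat.ofNat_ne_zero,
    not_false_eq_true, zero_pow]
  linear_combination (-8 * (1 + t) / (1 - t)) * E2 + S02 * c02 + S01 * c01 + S00 * c00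

-- The extended map and regularity near the origin

attribute [local fun_prop] analyticAt_fst analyticAt_snd

/-- The holomorphic extension of `(u, v) ↦ φ(-1 + 2uv, 1 + 2v)` across `v = 0`. -/
noncomputable def hornPhiExt (p : ℂ × ℂ) : ℂ × ℂ :=
  (-4 * p.1 * (1 - p.1 * p.2) * (1 - 2 * p.1 * p.2 + 2 * p.1 ^ 2 * p.2 ^ 2) *
      ((1 + p.2) * (1 + 2 * p.2 + 2 * p.2 ^ 2)) /
      ((1 - p.1 - 2 * p.1 * p.2) ^ 2 * (1 + p.2 - p.1 * p.2 - 2 * p.1 * p.2 ^ 2) ^ 2),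
    (p.2 * (1 - p.1 - 2 * p.1 * p.2) / (1 + p.2 - p.1 * p.2 - 2 * p.1 * p.2 ^ 2)) ^ 2)

/-- The points `(u, v)` at which all the series and principal powers involved are regular. -/
structure IsRegularPoint (ρ r₁ r₂ : ℝ) (p : ℂ × ℂ) : Prop where
  norm_fst : ‖(hornPhiExt p).1‖ < ρ
  norm_snd : ‖(hornPhiExt p).2‖ < ρ
  base_fst : 1 + p.2 - p.1 * p.2 - 2 * p.1 * p.2 ^ 2 ∈ Complex.slitPlane
  base_snd : (1 - p.1 - 2 * p.1 * p.2) / ((1 + p.2) * (1 + 2 * p.2 + 2 * p.2 ^ 2)) ∈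
    Complex.slitPlane
  den_ne : (1 + p.2) * (1 + 2 * p.2 + 2 * p.2 ^ 2) ≠ 0
  arg_ne : (1 - p.1 * p.2) * (1 - 2 * p.1 * p.2 + 2 * p.1 ^ 2 * p.2 ^ 2) ≠ 0
  norm_arg_fst : ‖8 * p.1 * p.2 * (1 - p.1 * p.2) * (1 - 2 * p.1 * p.2 + 2 * p.1 ^ 2 * p.2 ^ 2)‖ < r₁
  norm_arg_snd : ‖-8 * p.2 * (1 + p.2) * (1 + 2 * p.2 + 2 * p.2 ^ 2)‖ < r₂

namespace IsRegularPoint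

variable {ρ r₁ r₂ : ℝ} {p : ℂ × ℂ}

theorem base_fst_ne (h : IsRegularPoint ρ r₁ r₂ p) :
    1 + p.2 - p.1 * p.2 - 2 * p.1 * p.2 ^ 2 ≠ 0 :=
  Complex.slitPlane_ne_zero h.base_fst

theorem num_ne (h : IsRegularPoint ρ r₁ r₂ p) : 1 - p.1 - 2 * p.1 * p.2 ≠ 0 := fun e =>
  Complex.slitPlane_ne_zero h.base_snd (by rw [e, zero_div])

theorem analyticAt_hornPhiExt (h : IsRegularPoint ρ r₁ r₂ p) : AnalyticAt ℂ hornPhiExt p := by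
  have h1 := h.base_fst_ne
  have h2 := h.num_ne
  have h3 := mul_ne_zero (pow_ne_zero 2 h2) (pow_ne_zero 2 h1)
  unfold hornPhiExt
  refine AnalyticAt.prod (AnalyticAt.fun_div (by fun_prop) (by fun_prop) h3)
    ((AnalyticAt.fun_div (f := fun p : ℂ × ℂ => p.2 * (1 - p.1 - 2 * p.1 * p.2))
      (by fun_prop) (by fun_prop) h1).fun_pow 2)

theorem eq_hornPhi (h : IsRegularPoint ρ r₁ r₂ p) (hp : p.2 ≠ 0) :
    hornPhiExt p = hornPhi (-1 + 2 * p.1 * p.2) (1 + 2 * p.2) := by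
  have h1 := h.base_fst_ne
  have h2 := h.num_ne
  obtain ⟨u, v⟩ := p
  simp only at h1 h2 hp
  -- In these coordinates `st + 1`, `s⁴ - 1` and `t⁴ - 1` each carry a factor `v`, while `st - 1`
  -- does not; so `v²` cancels in the first component of `φ`.
  have e1 : (-1 + 2 * u * v) * (1 + 2 * v) - 1 = -2 * (1 + v - u * v - 2 * u * v ^ 2) := by ring
  have e2 : (-1 + 2 * u * v) * (1 + 2 * v) + 1 = -2 * v * (1 - u - 2 * u * v) := by ring
  have e3 : (-1 + 2 * u * v) ^ 2 * (1 + 2 * v) ^ 2 - 1 =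
      (-2 * (1 + v - u * v - 2 * u * v ^ 2)) * (-2 * v * (1 - u - 2 * u * v)) := by
    rw [← e1, ← e2]; ring
  unfold hornPhiExt hornPhi
  simp only
  rw [e3, e1, e2]
  refine Prod.ext ?_ ?_
  · simp only
    field_simp
    ring
  · simp only
    field_simp

theorem sq_mul_sq_ne (h : IsRegularPoint ρ r₁ r₂ p) (hp : p.2 ≠ 0) :
    (-1 + 2 * p.1 * p.2) ^ 2 * (1 + 2 * p.2) ^ 2 ≠ 1 := by
  have h1 := h.base_fst_ne
  have h2 := h.num_ne
  rw [← sub_ne_zero]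
  have : (-1 + 2 * p.1 * p.2) ^ 2 * (1 + 2 * p.2) ^ 2 - 1 =
      4 * (p.2 * ((1 + p.2 - p.1 * p.2 - 2 * p.1 * p.2 ^ 2) * (1 - p.1 - 2 * p.1 * p.2))) := by
    ring
  rw [this]
  exact mul_ne_zero (by norm_num) (mul_ne_zero hp (mul_ne_zero h1 h2))

end IsRegularPoint

theorem hornPhiExt_zero : hornPhiExt (0, 0) = (0, 0) := by simp [hornPhiExt]

theorem eventually_isRegularPoint {ρ r₁ r₂ : ℝ} (hρ : 0 < ρ) (h₁ : 0 < r₁) (h₂ : 0 < r₂) :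
    ∀ᶠ p : ℂ × ℂ in 𝓝 (0, 0), IsRegularPoint ρ r₁ r₂ p := by
  have hΦ : ContinuousAt hornPhiExt (0, 0) := by
    unfold hornPhiExt
    refine ContinuousAt.prodMk (ContinuousAt.div (by fun_prop) (by fun_prop) (by simp))
      (ContinuousAt.pow (ContinuousAt.div (by fun_prop) (by fun_prop) (by simp)) 2)
  have c1 : ∀ᶠ p : ℂ × ℂ in 𝓝 (0, 0), ‖(hornPhiExt p).1‖ < ρ :=
    (hΦ.fst.norm).eventually_lt continuousAt_const (by simpa [hornPhiExt_zero] using hρ)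
  have c2 : ∀ᶠ p : ℂ × ℂ in 𝓝 (0, 0), ‖(hornPhiExt p).2‖ < ρ :=
    (hΦ.snd.norm).eventually_lt continuousAt_const (by simpa [hornPhiExt_zero] using hρ)
  have c3 : ∀ᶠ p : ℂ × ℂ in 𝓝 (0, 0),
      1 + p.2 - p.1 * p.2 - 2 * p.1 * p.2 ^ 2 ∈ Complex.slitPlane := by
    refine ContinuousAt.eventually_mem (by fun_prop) (Complex.isOpen_slitPlane.mem_nhds ?_)
    simp
  have c4 : ∀ᶠ p : ℂ × ℂ in 𝓝 (0, 0),
      (1 - p.1 - 2 * p.1 * p.2) / ((1 + p.2) * (1 + 2 * p.2 + 2 * p.2 ^ 2)) ∈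
        Complex.slitPlane := by
    refine ContinuousAt.eventually_mem (ContinuousAt.div (by fun_prop) (by fun_prop) (by simp))
      (Complex.isOpen_slitPlane.mem_nhds ?_)
    simp
  have c5 : ∀ᶠ p : ℂ × ℂ in 𝓝 (0, 0), (1 + p.2) * (1 + 2 * p.2 + 2 * p.2 ^ 2) ≠ 0 :=
    ContinuousAt.eventually_ne (by fun_prop) (by simp)
  have c6 : ∀ᶠ p : ℂ × ℂ in 𝓝 (0, 0),
      (1 - p.1 * p.2) * (1 - 2 * p.1 * p.2 + 2 * p.1 ^ 2 * p.2 ^ 2) ≠ 0 :=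
    ContinuousAt.eventually_ne (by fun_prop) (by simp)
  have c7 : ∀ᶠ p : ℂ × ℂ in 𝓝 (0, 0),
      ‖8 * p.1 * p.2 * (1 - p.1 * p.2) * (1 - 2 * p.1 * p.2 + 2 * p.1 ^ 2 * p.2 ^ 2)‖ < r₁ :=
    ContinuousAt.eventually_lt (by fun_prop) continuousAt_const (by simpa using h₁)
  have c8 : ∀ᶠ p : ℂ × ℂ in 𝓝 (0, 0),
      ‖-8 * p.2 * (1 + p.2) * (1 + 2 * p.2 + 2 * p.2 ^ 2)‖ < r₂ :=
    ContinuousAt.eventually_lt (by fun_prop) continuousAt_const (by simpa using h₂)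
  filter_upwards [c1, c2, c3, c4, c5, c6, c7, c8] with p h1 h2 h3 h4 h5 h6 h7 h8
  exact ⟨h1, h2, h3, h4, h5, h6, h7, h8⟩

/-- Puts both Gauss factors in the form `₂F₁(p, p - 1/4; 2p)`, with `p = 1 - q` and `p = q`, so that
`exists_gauss_quarticODE` covers both. -/
theorem gaussProduct_eq (q u v : ℂ) : gaussProduct q u v =
    (1 + v - u * v - 2 * u * v ^ 2) ^ (2 * q) *
      ((1 - u - 2 * u * v) / ((1 + v) * (1 + 2 * v + 2 * v ^ 2))) ^ (2 * q - 1) *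
      ₂F₁ (1 - q) (1 - q - 1 / 4) (2 * (1 - q)) (-8 * v * (1 + v) * (1 + 2 * v + 2 * v ^ 2)) *
      ₂F₁ q (q - 1 / 4) (2 * q)
        (8 * u * v * (1 - u * v) * (1 - 2 * u * v + 2 * u ^ 2 * v ^ 2)) := by
  have e1 : (3 / 4 - q : ℂ) = 1 - q - 1 / 4 := by ring
  have e2 : (2 - 2 * q : ℂ) = 2 * (1 - q) := by ring
  unfold gaussProduct
  rw [e1, e2]
  unfold ordinaryHypergeometric
  rw [ordinaryHypergeometricSeries_symm (𝔸 := ℂ) (q - 1 / 4) q]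

theorem IsRegularPoint.analyticAt_gaussProduct {ρ r₁ r₂ : ℝ} {p : ℂ × ℂ} {q : ℂ}
    (h : IsRegularPoint ρ r₁ r₂ p)
    (hF₁ : DifferentiableOn ℂ (₂F₁ q (q - 1 / 4) (2 * q)) (Metric.ball (0 : ℂ) r₁))
    (hF₂ : DifferentiableOn ℂ (₂F₁ (1 - q) (1 - q - 1 / 4) (2 * (1 - q))) (Metric.ball (0 : ℂ) r₂)) :
    AnalyticAt ℂ (fun p : ℂ × ℂ => gaussProduct q p.1 p.2) p := by
  have a1 := hF₁.analyticAt (Metric.isOpen_ball.mem_nhds (mem_ball_zero_iff.2 h.norm_arg_fst))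
  have a2 := hF₂.analyticAt (Metric.isOpen_ball.mem_nhds (mem_ball_zero_iff.2 h.norm_arg_snd))
  simp only [gaussProduct_eq]
  refine AnalyticAt.fun_mul (AnalyticAt.fun_mul (AnalyticAt.fun_mul
    (AnalyticAt.cpow (by fun_prop) analyticAt_const h.base_fst)
    (AnalyticAt.cpow (AnalyticAt.fun_div (by fun_prop) (by fun_prop) h.den_ne) analyticAt_const
      h.base_snd)) ?_) ?_
  · exact AnalyticAt.fun_comp (f := fun p : ℂ × ℂ => -8 * p.2 * (1 + p.2) * (1 + 2 * p.2 + 2 * p.2 ^ 2))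
      a2 (by fun_prop)
  · exact AnalyticAt.fun_comp (f := fun p : ℂ × ℂ =>
      8 * p.1 * p.2 * (1 - p.1 * p.2) * (1 - 2 * p.1 * p.2 + 2 * p.1 ^ 2 * p.2 ^ 2))
      a1 (by fun_prop)

/-! ### The identity on `u = 0`, then for `v ≠ 0`, then everywhere -/

theorem HasDerivAt.cpow_mul_cpow {f g : ℂ → ℂ} {f' g' z : ℂ} (hf : HasDerivAt f f' z)
    (hg : HasDerivAt g g' z) (hf₀ : f z ∈ Complex.slitPlane) (hg₀ : g z ∈ Complex.slitPlane)
    (α β : ℂ) : HasDerivAt (fun z => f z ^ α * g z ^ β)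
      ((α * f' / f z + β * g' / g z) * (f z ^ α * g z ^ β)) z := by
  have h1 := Complex.slitPlane_ne_zero hf₀
  have h2 := Complex.slitPlane_ne_zero hg₀
  refine ((hf.cpow_const hf₀).fun_mul (hg.cpow_const hg₀)).congr_deriv ?_
  rw [Complex.cpow_sub _ _ h1, Complex.cpow_sub _ _ h2, Complex.cpow_one, Complex.cpow_one]
  field_simp

theorem cpow_mul_cpow_ne_zero {z w : ℂ} (hz : z ∈ Complex.slitPlane) (hw : w ∈ Complex.slitPlane)
    (α β : ℂ) : z ^ α * w ^ β ≠ 0 := by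
  simp [Complex.cpow_eq_zero_iff, Complex.slitPlane_ne_zero hz, Complex.slitPlane_ne_zero hw]

/-- The identity on `u = 0`. -/
theorem hornH1_hornPhiExt_zero_left {q : ℂ} (h2 : ∀ n : ℕ, 2 - 2 * q ≠ -(n : ℂ)) {K ρ r₁ r₂ ε : ℝ}
    (hK : GeomBound (hornCoeff (q - 1 / 2) q (1 / 2) (2 * q)) K) (hK0 : 0 ≤ K) (hρ : 0 ≤ ρ)
    (hKρ : 4 * K * ρ < 1)
    (hF₂ : DifferentiableOn ℂ (₂F₁ (1 - q) (1 - q - 1 / 4) (2 * (1 - q))) (Metric.ball (0 : ℂ) r₂))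
    (hF₂' : ∀ s : ℂ, ‖1 - s ^ 4‖ < r₂ → s ^ 4 ≠ 1 → QuarticODE (1 - q)
      (fun s => ₂F₁ (1 - q) (1 - q - 1 / 4) (2 * (1 - q)) (1 - s ^ 4)) s)
    (hε : ∀ u v : ℂ, ‖u‖ < ε → ‖v‖ < ε → IsRegularPoint ρ r₁ r₂ (u, v)) {v : ℂ} (hv : ‖v‖ < ε) :
    hornH1 (q - 1 / 2) q (1 / 2) (2 * q) (hornPhiExt (0, v)).1 (hornPhiExt (0, v)).2 =
      gaussProduct q 0 v := by
  have hε0 : 0 < ε := (norm_nonneg v).trans_lt hv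
  -- The disc `‖v‖ < ε` in the coordinate `t = 1 + 2v`.
  set U : Set ℂ := Metric.ball 1 (2 * ε) with hUdef
  have hU : IsOpen U := Metric.isOpen_ball
  have hUv : ∀ t ∈ U, ‖(t - 1) / 2‖ < ε := fun t ht => by
    rw [hUdef, Metric.mem_ball, dist_eq_norm] at ht
    rw [norm_div, Complex.norm_ofNat, div_lt_iff₀ (by norm_num)]
    linarith
  have hreg : ∀ t ∈ U, IsRegularPoint ρ r₁ r₂ (0, (t - 1) / 2) := fun t ht =>
    hε 0 _ (by simpa using hε0) (hUv t ht)
  have hden : ∀ t ∈ U, (1 + t) * (1 + t ^ 2) ≠ 0 := fun t ht h => (hreg t ht).den_ne (by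
    simp only
    linear_combination h / 4)
  have m1 : ∀ t ∈ U, 1 + t ≠ 0 := fun t ht => left_ne_zero_of_mul (hden t ht)
  have m2 : ∀ t ∈ U, 1 + t ^ 2 ≠ 0 := fun t ht => right_ne_zero_of_mul (hden t ht)
  have ha : ∀ t ∈ U, (1 + t) / 2 ∈ Complex.slitPlane := fun t ht => by
    have := (hreg t ht).base_fst
    simp only at this
    convert this using 1
    ring
  have hbeq : ∀ t ∈ U, (1 - 0 - 2 * 0 * ((t - 1) / 2)) / ((1 + (t - 1) / 2) *
      (1 + 2 * ((t - 1) / 2) + 2 * ((t - 1) / 2) ^ 2)) = 4 / ((1 + t) * (1 + t ^ 2)) := by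
    intro t ht
    have : (1 + (t - 1) / 2) * (1 + 2 * ((t - 1) / 2) + 2 * ((t - 1) / 2) ^ 2) =
      (1 + t) * (1 + t ^ 2) / 4 := by ring
    rw [this]
    have := m1 t ht
    have := m2 t ht
    field_simp
    ring
  have hb : ∀ t ∈ U, 4 / ((1 + t) * (1 + t ^ 2)) ∈ Complex.slitPlane := fun t ht => by
    rw [← hbeq t ht]
    exact (hreg t ht).base_snd
  set P : ℂ → ℂ := fun t => ((1 + t) / 2) ^ (2 * q) *
    (4 / ((1 + t) * (1 + t ^ 2))) ^ (2 * q - 1) with hPdef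
  have hP0 : ∀ t ∈ U, P t ≠ 0 := fun t ht => cpow_mul_cpow_ne_zero (ha t ht) (hb t ht) _ _
  have hP : ∀ t ∈ U, HasDerivAt P
      ((1 / (1 + t) + (1 - 2 * q) * (2 * t / (1 + t ^ 2))) * P t) t := by
    intro t ht
    have n1 := m1 t ht
    have n2 := m2 t ht
    have da : HasDerivAt (fun t : ℂ => (1 + t) / 2) (1 / 2) t :=
      ((hasDerivAt_id' t).const_add 1).div_const 2
    have db : HasDerivAt (fun t : ℂ => 4 / ((1 + t) * (1 + t ^ 2))) _ t :=
      (hasDerivAt_const t (4 : ℂ)).fun_div (((hasDerivAt_id' t).const_add 1).fun_mul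
        ((hasDerivAt_pow 2 t).const_add 1)) (hden t ht)
    refine (da.cpow_mul_cpow db (ha t ht) (hb t ht) _ _).congr_deriv ?_
    simp only [hPdef]
    congr 1
    push_cast
    field_simp
    ring
  have hΦ : ∀ t ∈ U, hornPhiExt (0, (t - 1) / 2) = hornPhi (-1) t := by
    intro t ht
    have n1 := m1 t ht
    have e1 : -1 * t + 1 = -(t - 1) := by ring
    have e2 : -1 * t - 1 = -(1 + t) := by ring
    have e3 : 1 + (t - 1) / 2 - 0 * ((t - 1) / 2) - 2 * 0 * ((t - 1) / 2) ^ 2 = (1 + t) / 2 := by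
      ring
    refine Prod.ext ?_ ?_
    · simp only [hornPhiExt, hornPhi]
      norm_num
    · simp only [hornPhiExt, hornPhi]
      rw [e1, e2, e3]
      field_simp
      ring
  have hx : ∀ t ∈ U, ‖(hornPhi (-1) t).1‖ ≤ ρ := fun t ht => by
    rw [← hΦ t ht]; exact (hreg t ht).norm_fst.le
  have hy : ∀ t ∈ U, ‖(hornPhi (-1) t).2‖ ≤ ρ := fun t ht => by
    rw [← hΦ t ht]; exact (hreg t ht).norm_snd.le
  have harg : ∀ t : ℂ, -8 * ((t - 1) / 2) * (1 + (t - 1) / 2) *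
      (1 + 2 * ((t - 1) / 2) + 2 * ((t - 1) / 2) ^ 2) = 1 - t ^ 4 := fun t => by ring
  have harg' : ∀ t ∈ U, ‖1 - t ^ 4‖ < r₂ := fun t ht => by
    rw [← harg]; exact (hreg t ht).norm_arg_snd
  have ht4 : ∀ t ∈ U \ {1}, t ^ 4 ≠ 1 := fun t ht h => by
    have hne : t - 1 ≠ 0 := sub_ne_zero.2 ht.2
    exact mul_ne_zero hne (hden t ht.1) (by linear_combination h)
  have hV : IsOpen (U \ {1}) := hU.sdiff isClosed_singleton
  have hmem : ∀ᶠ t in 𝓝[≠] (1 : ℂ), t ∈ U \ {1} := by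
    filter_upwards [self_mem_nhdsWithin, nhdsWithin_le_nhds (hU.mem_nhds
      (Metric.mem_ball_self (by linarith : 0 < 2 * ε)))] with t h1 h2 using ⟨h2, h1⟩
  have hdY : DifferentiableOn ℂ (fun t => (hornPhi (-1) t).2) U := by
    unfold hornPhi
    refine DifferentiableOn.pow (DifferentiableOn.div (by fun_prop) (by fun_prop) fun t ht => ?_) 2
    have := m1 t ht
    rw [show -1 * t - 1 = -(1 + t) by ring]
    exact neg_ne_zero.2 this
  have hdX : DifferentiableOn ℂ (fun t => (hornPhi (-1) t).1) U := by
    have : (fun t => (hornPhi (-1) t).1) = fun _ => 0 := funext fun t => by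
      simp only [hornPhi]; norm_num
    rw [this]
    exact differentiableOn_const 0
  have hp2 : ∀ n : ℕ, 2 * (1 - q) ≠ -(n : ℂ) := fun n h => h2 n (by linear_combination h)
  -- Uniqueness is applied at `t = 1`, i.e. `v = 0`. There `φ(-1, 1) = (0, 0)` and `P 1 = 1`, so the
  -- proportionality constant is `H₁(0, 0) = 1`.
  have key := QuarticODE.eqOn_const_mul hp2 (s₀ := 1) (by norm_num) hU
    (convex_ball _ _).isPreconnected (Metric.mem_ball_self (by linarith))
    (f := fun t => hornH1 (q - 1 / 2) q (1 / 2) (2 * q) (hornPhi (-1) t).1 (hornPhi (-1) t).2 / P t)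
    (g := fun t => ₂F₁ (1 - q) (1 - q - 1 / 4) (2 * (1 - q)) (1 - t ^ 4))
    ((hK.differentiableOn hK0 hρ (by nlinarith [mul_nonneg hK0 hρ]) hU hdX hdY hx hy).fun_div
      (fun t ht => (hP t ht).differentiableAt.differentiableWithinAt) hP0)
    (hF₂.fun_comp (by fun_prop) fun t ht => mem_ball_zero_iff.2 (harg' t ht))
    (by norm_num [ordinaryHypergeometric_zero])
    (hmem.mono fun t ht => hornH1_hornPhi_neg_one_quarticODE h2 hK hK0 hρ hKρ hV
      (fun t ht => hP0 t ht.1) (fun t ht => hP t ht.1) ht4 (fun t ht => hy t ht.1) ht)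
    (hmem.mono fun t ht => hF₂' t (harg' t ht.1) (ht4 t ht))
  have hvU : 1 + 2 * v ∈ U := by
    rw [hUdef, Metric.mem_ball, dist_eq_norm, add_sub_cancel_left, norm_mul, Complex.norm_ofNat]
    linarith
  have h3 := key _ hvU
  have hΦ1 : hornPhi (-1) 1 = (0, 0) := by simp [hornPhi]
  have hP1 : P 1 = 1 := by simp only [hPdef]; norm_num
  have hve : (1 + 2 * v - 1) / 2 = v := by ring
  rw [← hΦ _ hvU, hΦ1, hP1, hve, div_eq_iff (hP0 _ hvU), hornH1_eq_doubleSeries (y := 0),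
    doubleSeries_zero_zero, hornCoeff_zero_zero, ← harg, hve] at h3
  rw [h3, gaussProduct_eq]
  have e1 := hbeq _ hvU
  rw [hve] at e1
  simp only [hPdef]
  rw [← e1]
  have e2 : (1 + (1 + 2 * v)) / 2 = 1 + v - 0 * v - 2 * 0 * v ^ 2 := by ring
  rw [e2]
  simp only [mul_zero, zero_mul, ordinaryHypergeometric_zero]
  ring

/-- The identity away from `v = 0`. -/
theorem hornH1_hornPhiExt_of_ne {q : ℂ} (h1 : ∀ n : ℕ, 2 * q ≠ -(n : ℂ))
    (h2 : ∀ n : ℕ, 2 - 2 * q ≠ -(n : ℂ)) {K ρ r₁ r₂ ε : ℝ}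
    (hK : GeomBound (hornCoeff (q - 1 / 2) q (1 / 2) (2 * q)) K) (hK0 : 0 ≤ K) (hρ : 0 ≤ ρ)
    (hKρ : 4 * K * ρ < 1)
    (hF₁ : DifferentiableOn ℂ (₂F₁ q (q - 1 / 4) (2 * q)) (Metric.ball (0 : ℂ) r₁))
    (hF₁' : ∀ s : ℂ, ‖1 - s ^ 4‖ < r₁ → s ^ 4 ≠ 1 → QuarticODE q
      (fun s => ₂F₁ q (q - 1 / 4) (2 * q) (1 - s ^ 4)) s)
    (hF₂ : DifferentiableOn ℂ (₂F₁ (1 - q) (1 - q - 1 / 4) (2 * (1 - q))) (Metric.ball (0 : ℂ) r₂))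
    (hF₂' : ∀ s : ℂ, ‖1 - s ^ 4‖ < r₂ → s ^ 4 ≠ 1 → QuarticODE (1 - q)
      (fun s => ₂F₁ (1 - q) (1 - q - 1 / 4) (2 * (1 - q)) (1 - s ^ 4)) s)
    (hε : ∀ u v : ℂ, ‖u‖ < ε → ‖v‖ < ε → IsRegularPoint ρ r₁ r₂ (u, v)) {u v : ℂ} (hu : ‖u‖ < ε)
    (hv : ‖v‖ < ε) (hv0 : v ≠ 0) :
    hornH1 (q - 1 / 2) q (1 / 2) (2 * q) (hornPhiExt (u, v)).1 (hornPhiExt (u, v)).2 =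
      gaussProduct q u v := by
  have hε0 : 0 < ε := (norm_nonneg v).trans_lt hv
  have hnv : 0 < ‖v‖ := norm_pos_iff.2 hv0
  have hr : 0 < 2 * ‖v‖ * ε := by positivity
  obtain ⟨t, ht⟩ : ∃ t : ℂ, t = 1 + 2 * v := ⟨_, rfl⟩
  -- The disc `‖u‖ < ε` in the coordinate `s = -1 + 2uv`. It degenerates as `v → 0`, which is why `v
  -- = 0` is excluded.
  set U : Set ℂ := Metric.ball (-1) (2 * ‖v‖ * ε) with hUdef
  have hU : IsOpen U := Metric.isOpen_ball
  have hUu : ∀ s ∈ U, ‖(s + 1) / (2 * v)‖ < ε := fun s hs => by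
    rw [hUdef, Metric.mem_ball, dist_eq_norm, sub_neg_eq_add] at hs
    rw [norm_div, norm_mul, Complex.norm_ofNat, div_lt_iff₀ (by positivity)]
    linarith
  have hreg : ∀ s ∈ U, IsRegularPoint ρ r₁ r₂ ((s + 1) / (2 * v), v) := fun s hs =>
    hε _ _ (hUu s hs) hv
  have hsu : ∀ s : ℂ, -1 + 2 * ((s + 1) / (2 * v)) * v = s := fun s => by field_simp; ring
  have hΦ : ∀ s ∈ U, hornPhiExt ((s + 1) / (2 * v), v) = hornPhi s t := fun s hs => by
    have := (hreg s hs).eq_hornPhi hv0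
    simp only [hsu, ← ht] at this
    exact this
  have hst : ∀ s ∈ U, s ^ 2 * t ^ 2 ≠ 1 := fun s hs => by
    have := (hreg s hs).sq_mul_sq_ne hv0
    simp only [hsu, ← ht] at this
    exact this
  have n2 : ∀ s ∈ U, 1 - s * t ≠ 0 := fun s hs h => hst s hs (by
    linear_combination (-1 - s * t) * h)
  have n3 : ∀ s ∈ U, 1 + s * t ≠ 0 := fun s hs h => hst s hs (by
    linear_combination (s * t - 1) * h)
  have hL : (1 + v) * (1 + 2 * v + 2 * v ^ 2) ≠ 0 :=
    (hreg (-1) (Metric.mem_ball_self hr)).den_ne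
  have ht4 : t ^ 4 - 1 ≠ 0 := by
    have : t ^ 4 - 1 = 8 * (v * ((1 + v) * (1 + 2 * v + 2 * v ^ 2))) := by rw [ht]; ring
    rw [this]
    exact mul_ne_zero (by norm_num) (mul_ne_zero hv0 hL)
  have haeq : ∀ s : ℂ, 1 + v - (s + 1) / (2 * v) * v - 2 * ((s + 1) / (2 * v)) * v ^ 2 =
      (1 - s * t) / 2 := fun s => by rw [ht]; field_simp; ring
  have hbeq : ∀ s : ℂ, (1 - (s + 1) / (2 * v) - 2 * ((s + 1) / (2 * v)) * v) /
      ((1 + v) * (1 + 2 * v + 2 * v ^ 2)) = -4 * (1 + s * t) / (t ^ 4 - 1) := fun s => by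
    rw [div_eq_div_iff hL ht4, ht]
    field_simp
    ring
  have ha : ∀ s ∈ U, (1 - s * t) / 2 ∈ Complex.slitPlane := fun s hs => by
    rw [← haeq]; exact (hreg s hs).base_fst
  have hb : ∀ s ∈ U, -4 * (1 + s * t) / (t ^ 4 - 1) ∈ Complex.slitPlane := fun s hs => by
    rw [← hbeq]; exact (hreg s hs).base_snd
  set P : ℂ → ℂ := fun s => ((1 - s * t) / 2) ^ (2 * q) *
    (-4 * (1 + s * t) / (t ^ 4 - 1)) ^ (2 * q - 1) with hPdef
  have hP0 : ∀ s ∈ U, P s ≠ 0 := fun s hs => cpow_mul_cpow_ne_zero (ha s hs) (hb s hs) _ _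
  have hP : ∀ s ∈ U, HasDerivAt P
      ((-t - (4 * q - 1) * s * t ^ 2) / ((1 - s * t) * (1 + s * t)) * P s) s := by
    intro s hs
    have k2 := n2 s hs
    have k3 := n3 s hs
    have hlin : HasDerivAt (fun s : ℂ => s * t) t s := by
      simpa using (hasDerivAt_id s).mul_const t
    have da : HasDerivAt (fun s : ℂ => (1 - s * t) / 2) (-t / 2) s :=
      (hlin.const_sub 1).div_const 2
    have db : HasDerivAt (fun s : ℂ => -4 * (1 + s * t) / (t ^ 4 - 1)) (-4 * t / (t ^ 4 - 1)) s :=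
      ((hlin.const_add 1).const_mul (-4)).div_const _
    refine (da.cpow_mul_cpow db (ha s hs) (hb s hs) _ _).congr_deriv ?_
    have e1 : 2 * q * (-t / 2) / ((1 - s * t) / 2) = -(2 * q * t) / (1 - s * t) := by
      field_simp
    have e2 : (2 * q - 1) * (-4 * t / (t ^ 4 - 1)) / (-4 * (1 + s * t) / (t ^ 4 - 1)) =
        (2 * q - 1) * t / (1 + s * t) := by
      field_simp
    rw [e1, e2, div_add_div _ _ k2 k3]
    simp only [hPdef]
    congr 2
    ring
  have hx : ∀ s ∈ U, ‖(hornPhi s t).1‖ ≤ ρ := fun s hs => by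
    rw [← hΦ s hs]; exact (hreg s hs).norm_fst.le
  have hy : ∀ s ∈ U, ‖(hornPhi s t).2‖ ≤ ρ := fun s hs => by
    rw [← hΦ s hs]; exact (hreg s hs).norm_snd.le
  have harg : ∀ u : ℂ, 8 * u * v * (1 - u * v) * (1 - 2 * u * v + 2 * u ^ 2 * v ^ 2) =
      1 - (-1 + 2 * u * v) ^ 4 := fun u => by ring
  have harg' : ∀ s ∈ U, ‖1 - s ^ 4‖ < r₁ := fun s hs => by
    have := (hreg s hs).norm_arg_fst
    simp only [harg, hsu] at this
    exact this
  have hs4 : ∀ s ∈ U \ {-1}, s ^ 4 ≠ 1 := fun s hs h => by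
    have hne : s + 1 ≠ 0 := fun e => hs.2 (eq_neg_of_add_eq_zero_left e)
    have h3 := (hreg s hs.1).arg_ne
    have h4 := harg ((s + 1) / (2 * v))
    rw [hsu, h, sub_self, mul_assoc, mul_eq_zero] at h4
    refine h4.elim (fun h5 => ?_) h3
    simp [hv0, hne] at h5
  have hV : IsOpen (U \ {-1}) := hU.sdiff isClosed_singleton
  have hmem : ∀ᶠ s in 𝓝[≠] (-1 : ℂ), s ∈ U \ {-1} := by
    filter_upwards [self_mem_nhdsWithin, nhdsWithin_le_nhds (hU.mem_nhds
      (Metric.mem_ball_self hr))] with s h1 h2 using ⟨h2, h1⟩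
  have hdX : DifferentiableOn ℂ (fun s => (hornPhi s t).1) U := by
    unfold hornPhi
    refine DifferentiableOn.div (by fun_prop) (by fun_prop) fun s hs => pow_ne_zero 2 ?_
    exact sub_ne_zero.2 (hst s hs)
  have hdY : DifferentiableOn ℂ (fun s => (hornPhi s t).2) U := by
    unfold hornPhi
    refine DifferentiableOn.pow (DifferentiableOn.div (by fun_prop) (by fun_prop) fun s hs => ?_) 2
    rw [← neg_sub]
    exact neg_ne_zero.2 (n2 s hs)
  have key := QuarticODE.eqOn_const_mul h1 (s₀ := -1) (by norm_num) hU
    (convex_ball _ _).isPreconnected (Metric.mem_ball_self hr)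
    (f := fun s => hornH1 (q - 1 / 2) q (1 / 2) (2 * q) (hornPhi s t).1 (hornPhi s t).2 / P s)
    (g := fun s => ₂F₁ q (q - 1 / 4) (2 * q) (1 - s ^ 4))
    ((hK.differentiableOn hK0 hρ (by nlinarith [mul_nonneg hK0 hρ]) hU hdX hdY hx hy).fun_div
      (fun s hs => (hP s hs).differentiableAt.differentiableWithinAt) hP0)
    (hF₁.fun_comp (by fun_prop) fun s hs => mem_ball_zero_iff.2 (harg' s hs))
    (by norm_num [ordinaryHypergeometric_zero])
    (hmem.mono fun s hs => hornH1_hornPhi_quarticODE h1 h2 hK hK0 hρ hKρ hV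
      (fun s hs => hP0 s hs.1) (fun s hs => hP s hs.1) hs4 (fun s hs => hst s hs.1)
      (fun s hs => hx s hs.1) (fun s hs => hy s hs.1) hs)
    (hmem.mono fun s hs => hF₁' s (harg' s hs.1) (hs4 s hs))
  have huU : -1 + 2 * u * v ∈ U := by
    rw [hUdef, Metric.mem_ball, dist_eq_norm, sub_neg_eq_add, neg_add_cancel_comm, norm_mul,
      norm_mul, Complex.norm_ofNat]
    nlinarith
  have hus : (-1 + 2 * u * v + 1) / (2 * v) = u := by field_simp; ring
  have hu0 : ((-1 : ℂ) + 1) / (2 * v) = 0 := by simp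
  have h3 := key _ huU
  have hPeq : ∀ s, P s = (1 + v - (s + 1) / (2 * v) * v - 2 * ((s + 1) / (2 * v)) * v ^ 2) ^ (2 * q) *
      ((1 - (s + 1) / (2 * v) - 2 * ((s + 1) / (2 * v)) * v) /
      ((1 + v) * (1 + 2 * v + 2 * v ^ 2))) ^ (2 * q - 1) := fun s => by rw [haeq, hbeq]
  have hP1 := hP0 _ (Metric.mem_ball_self hr)
  rw [← hΦ _ huU, ← hΦ _ (Metric.mem_ball_self hr), hus, hu0, div_eq_iff (hP0 _ huU),
    hornH1_hornPhiExt_zero_left h2 hK hK0 hρ hKρ hF₂ hF₂' hε hv, ← harg] at h3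
  -- The constant of proportionality is `gaussProduct q 0 v / P (-1)`. Since `P` is exactly the
  -- prefactor of `gaussProduct`, the quotient is the Gauss factor in `v` alone.
  have hg0 : gaussProduct q 0 v = P (-1) *
      ₂F₁ (1 - q) (1 - q - 1 / 4) (2 * (1 - q)) (-8 * v * (1 + v) * (1 + 2 * v + 2 * v ^ 2)) := by
    rw [gaussProduct_eq, hPeq, hu0]
    simp only [mul_zero, zero_mul, ordinaryHypergeometric_zero, mul_one]
  rw [h3, hg0, gaussProduct_eq, mul_div_cancel_left₀ _ hP1, hPeq (-1 + 2 * u * v), hus]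
  ring

theorem mainTheorem2 (q₀ : ℂ)
    (h₁ : ∀ n : ℕ, 2 * q₀ ≠ -(n : ℂ)) (h₂ : ∀ n : ℕ, 2 - 2 * q₀ ≠ -(n : ℂ)) :
    ∃ Φ : ℂ × ℂ → ℂ × ℂ,
      -- `Φ` is the holomorphic extension of `φ(-1 + 2uv, 1 + 2v)` across `v = 0`
      AnalyticAt ℂ Φ (0, 0) ∧ Φ (0, 0) = (0, 0) ∧
      (∀ᶠ p : ℂ × ℂ in 𝓝 (0, 0), p.2 ≠ 0 →
        ((-1 + 2 * p.1 * p.2) ^ 2 * (1 + 2 * p.2) ^ 2 ≠ 1 ∧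
          Φ p = hornPhi (-1 + 2 * p.1 * p.2) (1 + 2 * p.2))) ∧
      -- the series `H₁` converges absolutely along `Φ` near the origin
      (∀ᶠ p : ℂ × ℂ in 𝓝 (0, 0), Summable fun k : ℕ × ℕ =>
        hornH1Term (q₀ - 1 / 2) q₀ (1 / 2) (2 * q₀) (Φ p).1 (Φ p).2 k.1 k.2) ∧
      AnalyticAt ℂ
        (fun p : ℂ × ℂ => hornH1 (q₀ - 1 / 2) q₀ (1 / 2) (2 * q₀) (Φ p).1 (Φ p).2) (0, 0) ∧
      AnalyticAt ℂ (fun p : ℂ × ℂ => gaussProduct q₀ p.1 p.2) (0, 0) ∧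
      (∀ᶠ p : ℂ × ℂ in 𝓝 (0, 0),
        hornH1 (q₀ - 1 / 2) q₀ (1 / 2) (2 * q₀) (Φ p).1 (Φ p).2 = gaussProduct q₀ p.1 p.2) := by
  have ha : ∀ n : ℕ, 1 - (q₀ - 1 / 2) + n ≠ 0 := fun n h => h₂ (2 * n + 1) (by
    push_cast; linear_combination 2 * h)
  have hd : ∀ n : ℕ, 2 * q₀ + n ≠ 0 := fun n h => h₁ n (eq_neg_of_add_eq_zero_left h)
  obtain ⟨K, hK1, hK⟩ := geomBound_hornCoeff ha hd q₀ (1 / 2)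
  obtain ⟨r₁, hr₁, hF₁, hF₁'⟩ := exists_gauss_quarticODE h₁ h₂
  obtain ⟨r₂, hr₂, hF₂, hF₂'⟩ := exists_gauss_quarticODE (p := 1 - q₀)
    (fun n h => h₂ n (by linear_combination h)) (fun n h => h₁ n (by linear_combination h))
  have hK0 : 0 < K := by linarith
  have hρ : 0 < 1 / (8 * K) := by positivity
  have hKρ : 4 * K * (1 / (8 * K)) < 1 := by field_simp; norm_num
  have hKρ' : K * (1 / (8 * K)) < 1 := by field_simp; norm_num
  have hreg := eventually_isRegularPoint hρ hr₁ hr₂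
  obtain ⟨ε, hε, hball⟩ := Metric.eventually_nhds_iff_ball.1 hreg
  have hball' : ∀ u v : ℂ, ‖u‖ < ε → ‖v‖ < ε → IsRegularPoint (1 / (8 * K)) r₁ r₂ (u, v) :=
    fun u v hu hv => hball _ (by simpa [Prod.dist_eq] using ⟨hu, hv⟩)
  have hne := fun u v (hu : ‖u‖ < ε) (hv : ‖v‖ < ε) (hv0 : v ≠ 0) =>
    hornH1_hornPhiExt_of_ne h₁ h₂ hK hK0.le hρ.le hKρ hF₁ hF₁' hF₂ hF₂' hball' hu hv hv0
  have heq : ∀ u v : ℂ, ‖u‖ < ε → ‖v‖ < ε →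
      hornH1 (q₀ - 1 / 2) q₀ (1 / 2) (2 * q₀) (hornPhiExt (u, v)).1 (hornPhiExt (u, v)).2 =
        gaussProduct q₀ u v := by
    intro u v hu hv
    -- For fixed `u` both sides are continuous in `v` at `0` and agree for small `v ≠ 0`.
    by_cases hv0 : v = 0
    · subst hv0
      have hr := hball' u 0 hu hv
      have hc : ContinuousAt (fun v : ℂ => (u, v)) 0 := by fun_prop
      have c1 : ContinuousAt (fun v => gaussProduct q₀ u v) 0 :=
        ContinuousAt.comp (g := fun p : ℂ × ℂ => gaussProduct q₀ p.1 p.2)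
          (f := fun v => (u, v)) (hr.analyticAt_gaussProduct hF₁ hF₂).continuousAt hc
      have c2 : ContinuousAt (fun v => hornH1 (q₀ - 1 / 2) q₀ (1 / 2) (2 * q₀)
          (hornPhiExt (u, v)).1 (hornPhiExt (u, v)).2) 0 := by
        have c3 : ContinuousAt (fun v => hornPhiExt (u, v)) 0 :=
          ContinuousAt.comp (f := fun v => (u, v)) hr.analyticAt_hornPhiExt.continuousAt hc
        have c4 : ContinuousAt (fun p : ℂ × ℂ =>
            doubleSeries (hornCoeff (q₀ - 1 / 2) q₀ (1 / 2) (2 * q₀)) p.1 p.2)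
            (hornPhiExt (u, 0)) :=
          hK.continuousAt hK0.le hρ.le hKρ' hr.norm_fst hr.norm_snd
        exact ContinuousAt.comp (f := fun v => hornPhiExt (u, v)) c4 c3
      have hev : ∀ᶠ v in 𝓝[≠] (0 : ℂ), hornH1 (q₀ - 1 / 2) q₀ (1 / 2) (2 * q₀)
          (hornPhiExt (u, v)).1 (hornPhiExt (u, v)).2 = gaussProduct q₀ u v := by
        filter_upwards [self_mem_nhdsWithin,
          nhdsWithin_le_nhds (Metric.ball_mem_nhds (0 : ℂ) hε)] with v h1 h2
        exact hne u v hu (mem_ball_zero_iff.1 h2) h1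
      exact tendsto_nhds_unique ((c2.tendsto.mono_left nhdsWithin_le_nhds).congr' hev)
        (c1.tendsto.mono_left nhdsWithin_le_nhds)
    · exact hne u v hu hv hv0
  have hev : ∀ᶠ p : ℂ × ℂ in 𝓝 (0, 0),
      hornH1 (q₀ - 1 / 2) q₀ (1 / 2) (2 * q₀) (hornPhiExt p).1 (hornPhiExt p).2 =
        gaussProduct q₀ p.1 p.2 := by
    filter_upwards [Metric.ball_mem_nhds ((0, 0) : ℂ × ℂ) hε] with p hp
    have : ‖p.1‖ < ε ∧ ‖p.2‖ < ε := by simpa [Prod.dist_eq] using hp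
    exact heq p.1 p.2 this.1 this.2
  have h0 := hreg.self_of_nhds
  have hG := h0.analyticAt_gaussProduct hF₁ hF₂
  -- Joint analyticity of the `H₁` side is transferred from the Gauss product through the identity
  -- just proved.
  exact ⟨hornPhiExt, h0.analyticAt_hornPhiExt, hornPhiExt_zero,
    hreg.mono fun p hp hp0 => ⟨hp.sq_mul_sq_ne hp0, hp.eq_hornPhi hp0⟩,
    hreg.mono fun p hp => hK.summable hK0.le hKρ' hp.norm_fst.le hp.norm_snd.le,
    hG.congr (hev.mono fun p hp => hp.symm), hG, hev⟩
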